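/- Setting. For $d\ge1$ and $\mathbf k\in\mathbb Z^d$ let $\varphi_{\mathbf 0}\equiv1$, $\varphi_{\mathbf k}(\mathbf x)=\sqrt2\cos(2\pi\mathbf k\cdot\mathbf x)$ if the first nonzero coordinate of $\mathbf k$ is positive, and $\varphi_{\mathbf k}(\mathbf x)=\sqrt2\sin(2\pi\mathbf k\cdot\mathbf x)$ if it is negative; for $f\in L^2([0,1]^d;\mathbb R)$ put $\theta_{\mathbf k}[f]=\int_{[0,1]^d} f\varphi_{\mathbf k}$ and $Q_j[f]=\sum_{\mathbf k:k_j\ne0}\theta_{\mathbf k}[f]^2$. For $L,\kappa>0$ and an integer $d^*\le d$, let $\Sigma(\kappa,L)$ be the set of all square integrable $f:[0,1]^d\to\mathbb R$ such that $\sum_{\mathbf k\in\mathbb Z^d}k_j^2\theta_{\mathbf k}[f]^2\le L$ for $j=1,\dots,d$ and such that, for some $J=J_f\subset\{1,\dots,d\}$ with $\mathrm{Card}(J)\le d^*$, $f(\mathbf x)$ depends on $\mathbf x$ only through $\mathbf x_J$ and $Q_j[f]\ge\kappa$ for all $j\in J$. One observes the Gaussian process $\{Y(\phi):\phi\in L^2([0,1]^d)\}$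 with $\mathbf E_f[Y(\phi)]=\int f\phi$ and $\mathrm{Cov}_f(Y(\phi),Y(\psi))=\frac1n\int\phi\psi$; its law is denoted by $\mathbf P_f$. An estimator of $J_f$ is a measurable function of $Y$ with values in the subsets of $\{1,\dots,d\}$. Let $n\to\infty$ and let $d=d_n$, $d^*=d^*_n$, $s=s_n$, $\kappa=\kappa_n$ depend on $n$, with $1\le s\le d^*\le d$, $s<d$, and with $d^*/s$ bounded from above by a constant. Put $$r_n=\Bigl(\frac{\log(d/s)}{n^2}\Bigr)^{2/(4+s)}\vee\frac{s\log(d/s)}{n}.$$ Proposition. Let $L>0$. 1. There is a constant $D^*>0$, depending only on $L$, such that the following holds. For all sequences $(d_n)$, $(d_n^*)$, $(\kappa_n)$ with $d_n\to\infty$ there are estimators $\widehat J_n$ (which may depend on $d_n,d_n^*,\kappa_n,L$ but not on $s_n$) such that, for every sequence $(s_n)$ as above with $\kappa_n\ge D^*r_n$ for all large $n$, $$\lim_{n\to\infty}\ \sup_{f\in\Sigma(\kappa_n,L),\ \mathrm{Card}(J_f)=s_n}\mathbf P_f(\widehat J_n\ne J_f)=0.$$ 2. There is a constant $D_*>0$,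 depending only on $L$, such that for all sequences as above with $0<\kappa_n\le L$ and $\kappa_n\le D_*r_n$ for all large $n$, uniformly consistent estimation of $J_f$ is impossible: there are $c>0$ and $n_0$ such that for all $n\ge n_0$ $$\inf_{\widetilde J}\ \sup_{f\in\Sigma(\kappa_n,L),\ \mathrm{Card}(J_f)=s_n}\mathbf P_f(\widetilde J\ne J_f)\ge c,$$ where the infimum is over all estimators $\widetilde J$. In this sense $r_n$ is the minimax rate of separation. -/

import Mathlib

open MeasureTheory ProbabilityTheory Filter Topology
open scoped ENNReal

noncomputable section

namespace SparsityPattern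

/-- The cube `[0,1]^d`, with Lebesgue measure as its `volume`. -/
abbrev Cube (d : ℕ) : Type := Fin d → unitInterval

/-- `k ∈ (ℤ^d)_+`: the first nonzero coordinate of `k` exists and is positive. -/
def FirstNonzeroPos {d : ℕ} (k : Fin d → ℤ) : Prop :=
  ∃ i, 0 < k i ∧ ∀ j < i, k j = 0

/-- The real inner product `k ⬝ x` of a frequency and a point of the cube. -/
def dot {d : ℕ} (k : Fin d → ℤ) (x : Cube d) : ℝ := ∑ i, (k i : ℝ) * (x i : ℝ)

open Classical in
/-- The real trigonometric basis of `L²([0,1]^d)`: `1` for `k = 0`, a cosine for `k ∈ (ℤ^d)_+`,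
a sine for `-k ∈ (ℤ^d)_+`. -/
def trig {d : ℕ} (k : Fin d → ℤ) (x : Cube d) : ℝ :=
  if k = 0 then 1
  else if FirstNonzeroPos k then √2 * Real.cos (2 * Real.pi * dot k x)
  else √2 * Real.sin (2 * Real.pi * dot k x)

/-- The Fourier coefficient `θ_k[f] = ⟨f, φ_k⟩`. -/
def theta {d : ℕ} (f : Cube d → ℝ) (k : Fin d → ℤ) : ℝ := ∫ x, f x * trig k x

/-- `Q_j[f] = ∑_{k : k_j ≠ 0} θ_k[f]²`, as an element of `[0,∞]`. -/
def Q {d : ℕ} (f : Cube d → ℝ) (j : Fin d) : ℝ≥0∞ :=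
  ∑' k : {k : Fin d → ℤ // k j ≠ 0}, ENNReal.ofReal (theta f k.1 ^ 2)

/-- The Sobolev class `Σ_L`: square integrable `f` with `∑_k k_j² θ_k[f]² ≤ L` for every `j`. -/
structure MemSobolev {d : ℕ} (L : ℝ) (f : Cube d → ℝ) : Prop where
  memLp : MemLp f 2 volume
  sum_le : ∀ j : Fin d,
    ∑' k : Fin d → ℤ, ENNReal.ofReal ((k j : ℝ) ^ 2 * theta f k ^ 2) ≤ ENNReal.ofReal L

/-- `f` satisfies condition `[C1(κ, L)]` with sparsity pattern `J` and sparsity bound `dstar`: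
`f ∈ Σ_L`, `Card J ≤ dstar`, `f(x)` is a function of `x_J` only, and `Q_j[f] ≥ κ` for `j ∈ J`.
The class `Σ(κ, L)` consists of the `f` for which such a `J = J_f` exists
(it is unique when `κ > 0`). -/
structure ConditionC1 {d : ℕ} (κ L : ℝ) (dstar : ℕ) (f : Cube d → ℝ) (J : Finset (Fin d)) :
    Prop where
  sobolev : MemSobolev L f
  card_le : J.card ≤ dstar
  sparse : ∃ fbar : (J → unitInterval) → ℝ, ∀ x : Cube d, f x = fbar (fun j => x j)
  relevant : ∀ j ∈ J, ENNReal.ofReal κ ≤ Q f j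

/-- The index set `L²([0,1]^d; ℝ)` of the observed process. -/
abbrev TestSpace (d : ℕ) : Type := Lp ℝ 2 (volume : Measure (Cube d))

/-- A realisation `(Y(φ))_{φ ∈ L²}` of the observed process, with the product `σ`-algebra. -/
abbrev Observation (d : ℕ) : Type := TestSpace d → ℝ

/-- `P` is the law of the observations in the Gaussian white noise model with signal `f` and
noise level `n^{-1/2}`: under `P` the coordinate process `Y(φ)` is Gaussian with
`E Y(φ) = ∫ f φ` and `Cov(Y(φ), Y(ψ)) = n⁻¹ ∫ φ ψ`. -/
structure IsWhiteNoiseLaw {d : ℕ} (n : ℕ) (f : Cube d → ℝ) (P : Measure (Observation d)) :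
    Prop where
  gaussian : IsGaussianProcess (fun (φ : TestSpace d) (Y : Observation d) => Y φ) P
  mean : ∀ φ : TestSpace d, ∫ Y, Y φ ∂P = ∫ x, f x * φ x
  cov : ∀ φ ψ : TestSpace d,
    covariance (fun Y : Observation d => Y φ) (fun Y : Observation d => Y ψ) P
      = (1 / (n : ℝ)) * ∫ x, φ x * ψ x

/-- Estimators of the sparsity pattern: measurable functions of the observations. -/
def IsEstimator {d : ℕ} (Jhat : Observation d → Finset (Fin d)) : Prop :=
  ∀ J, MeasurableSet {Y | Jhat Y = J}

/-- `sup P_f(Jhat ≠ J_f)` over the `f ∈ Σ(κ, L)` with `Card J_f = s`. -/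
def maxError {d : ℕ} (n dstar s : ℕ) (κ L : ℝ) (Jhat : Observation d → Finset (Fin d)) : ℝ≥0∞ :=
  ⨆ (f : Cube d → ℝ) (J : Finset (Fin d)) (P : Measure (Observation d))
    (_ : ConditionC1 κ L dstar f J) (_ : J.card = s) (_ : IsWhiteNoiseLaw n f P),
    P {Y | Jhat Y ≠ J}

/-- Consistency of a sequence of estimators, uniformly over the `f ∈ Σ(κ_n, L)` with
`Card J_f = s_n`. -/
def UniformlyConsistent (L : ℝ) (d dstar s : ℕ → ℕ) (κ : ℕ → ℝ)
    (Jhat : ∀ n, Observation (d n) → Finset (Fin (d n))) : Prop :=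
  Tendsto (fun n => maxError n (dstar n) (s n) (κ n) L (Jhat n)) atTop (𝓝 0)

/-- Impossibility of uniformly consistent estimation: for some `c > 0` and all large `n`, every
estimator has maximal error at least `c` over the `f ∈ Σ(κ_n, L)` with `Card J_f = s_n`. -/
def ConsistencyImpossible (L : ℝ) (d dstar s : ℕ → ℕ) (κ : ℕ → ℝ) : Prop :=
  ∃ c : ℝ, 0 < c ∧ ∃ n₀ : ℕ, ∀ n ≥ n₀, ∀ Jhat : Observation (d n) → Finset (Fin (d n)),
    IsEstimator Jhat → ENNReal.ofReal c ≤ maxError n (dstar n) (s n) (κ n) L Jhat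

/-- `(log(d/s)/n²)^{2/(4+s)} ∨ s log(d/s)/n`. -/
def rate (n d s : ℕ) : ℝ :=
  max ((Real.log ((d : ℝ) / s) / (n : ℝ) ^ 2) ^ ((2 : ℝ) / (4 + s)))
    (s * Real.log ((d : ℝ) / s) / n)

end SparsityPattern

end

noncomputable section

namespace SparsityPattern

/-! Write ℓ = log(d/s), and S = s(1 + ℓ) for the entropy of patterns of size s.

Upper bound. For a pattern J and j ∈ J, sum Y(φ_k)² over the frequencies k supported in J with k_j ≠
0 and |k|² ≤ 2L·Card(J)/κ, and keep j when the sum exceeds its noise level N/n by κ/4, where N is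
the number of frequencies. If j ∉ J_f, every θ_k with k_j ≠ 0 vanishes, so the sum is pure noise for
every J. If J = J_f and j ∈ J_f, the Sobolev condition leaves at most κ/2 outside the ball, hence at
least κ/2 inside (`le_sum_theta_sq`). The Chernoff bounds for chi-square variables
(`energyStat_ge_le`, `energyStat_le_le`) make each error at most exp(-6S) as soon as S ≲ nκ and N·S
≲ (nκ)²; this survives a union bound over all j and all patterns of all sizes. The estimator scans
every pattern satisfying these two inequalities, so it does not need s. Since N ≤ (15/√(κ/2L))^s
(`card_freqBall_le`), κ ≥ D·r_n implies both inequalities (`entropyBound_le_of_rate_le`).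

Lower bound. For each of the M = C(d,s) patterns J, spread the energy κ evenly over the p^s
frequencies of {1,…,p}^J with independent random signs. Relative to pure noise, the likelihood ratio
of this mixture has second moment B = cosh(nκ/p^s)^(p^s) (`integral_mixture_sq`). The events {Ĵ = J}
are disjoint, so Cauchy–Schwarz bounds the average probability of success by √(B/M)
(`sum_setIntegral_le_sqrt`). As M ≥ exp(sℓ), it suffices that B ≤ exp(sℓ/2). The choice p = 1 gives
the term sℓ/n of the rate; p = ⌊√(L/κ)⌋, the largest value that the Sobolev condition allows, gives
the other.

The maximal error is a supremum over laws, so the lower bound also needs white noise laws to exist: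
pure noise is built as an isonormal process, and signals are added by exponential tilting
(Cameron–Martin). -/

/-! ### Orthonormality of the trigonometric system. -/

lemma continuous_dot {d : ℕ} (k : Fin d → ℤ) : Continuous (dot k) := by
  unfold dot
  fun_prop

lemma continuous_trig {d : ℕ} (k : Fin d → ℤ) : Continuous (trig k) := by
  have := continuous_dot k
  unfold trig
  split_ifs <;> fun_prop

lemma abs_trig_le {d : ℕ} (k : Fin d → ℤ) (x : Cube d) : |trig k x| ≤ √2 := by
  unfold trig
  split_ifs
  · simp
  · rw [abs_mul, abs_of_nonneg (Real.sqrt_nonneg _)]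
    exact mul_le_of_le_one_right (Real.sqrt_nonneg _) (Real.abs_cos_le_one _)
  · rw [abs_mul, abs_of_nonneg (Real.sqrt_nonneg _)]
    exact mul_le_of_le_one_right (Real.sqrt_nonneg _) (Real.abs_sin_le_one _)

lemma memLp_trig {d : ℕ} (k : Fin d → ℤ) : MemLp (trig k) 2 volume :=
  MemLp.of_bound (continuous_trig k).aestronglyMeasurable (√2)
    (ae_of_all _ fun x => by simpa using abs_trig_le k x)

/-- The cosine of a nonconstant affine function with integral slope has mean zero. -/
lemma integral_unitInterval_cos {m : ℤ} (hm : m ≠ 0) (c : ℝ) :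
    ∫ t : unitInterval, Real.cos (2 * Real.pi * (m * (t : ℝ)) + c) = 0 := by
  rw [show (∫ t : unitInterval, Real.cos (2 * Real.pi * (m * (t : ℝ)) + c))
    = ∫ t in Set.Icc (0 : ℝ) 1, Real.cos (2 * Real.pi * (m * t) + c) from
      integral_subtype_comap measurableSet_Icc (fun t : ℝ => Real.cos (2 * Real.pi * (m * t) + c)),
    integral_Icc_eq_integral_Ioc, ← intervalIntegral.integral_of_le zero_le_one]
  have hm' : (m : ℝ) ≠ 0 := by exact_mod_cast hm
  have hne : 2 * Real.pi * m ≠ 0 := by positivity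
  have : ∀ t : ℝ, 2 * Real.pi * (m * t) + c = (2 * Real.pi * m) * t + c := fun t => by ring
  simp_rw [this]
  rw [intervalIntegral.integral_comp_mul_add (fun t => Real.cos t) hne]
  have h2 : 2 * Real.pi * m * 1 + c = c + m * (2 * Real.pi) := by ring
  rw [integral_cos, h2, Real.sin_add_int_mul_two_pi]
  simp

lemma dot_insertNth {d : ℕ} (i : Fin (d + 1)) (k : Fin (d + 1) → ℤ) (t : unitInterval)
    (y : Cube d) :
    dot k (i.insertNth t y : Cube (d + 1)) = k i * (t : ℝ) + dot (fun j => k (i.succAbove j)) y := by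
  unfold dot
  rw [Fin.sum_univ_succAbove _ i]
  simp

/-- A function that does not depend on `x_i` is orthogonal to all waves of frequency `k` with
`k_i ≠ 0`. -/
lemma integral_mul_cos_eq_zero {d : ℕ} {g : Cube d → ℝ} {i : Fin d}
    (hg : ∀ x t, g (Function.update x i t) = g x) {k : Fin d → ℤ} (hk : k i ≠ 0) (c : ℝ) :
    ∫ x, g x * Real.cos (2 * Real.pi * dot k x + c) = 0 := by
  obtain _ | d := d
  · exact i.elim0
  -- No integrability of `g` is assumed: a nonintegrable integrand has integral 0 by convention.
  -- Otherwise Fubini isolates `x_i`, on which only the cosine depends.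
  by_cases hint : Integrable (fun x => g x * Real.cos (2 * Real.pi * dot k x + c))
  swap
  · exact integral_undef hint
  have hmp := (volume_preserving_piFinSuccAbove (fun _ : Fin (d + 1) => unitInterval) i).symm
  rw [← hmp.integral_comp' (g := fun x => g x * Real.cos (2 * Real.pi * dot k x + c))]
  have hint' := (hmp.integrable_comp_emb (MeasurableEquiv.measurableEmbedding _)).2 hint
  rw [Measure.volume_eq_prod, integral_prod_symm _ (by exact hint')]
  refine integral_eq_zero_of_ae (ae_of_all _ fun y => ?_)
  have hgc : ∀ t, g (i.insertNth t y : Cube (d + 1)) = g (i.insertNth 0 y : Cube (d + 1)) := by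
    intro t
    rw [← hg (i.insertNth t y : Cube (d + 1)) 0, Fin.update_insertNth]
  simp only [MeasurableEquiv.piFinSuccAbove_symm_apply, Fin.insertNthEquiv, Equiv.coe_fn_mk,
    Pi.zero_apply]
  simp_rw [hgc, dot_insertNth]
  rw [integral_const_mul]
  have : ∀ t : unitInterval, 2 * Real.pi * (k i * (t : ℝ) + dot (fun j => k (i.succAbove j)) y) + c
    = 2 * Real.pi * (k i * (t : ℝ)) + (2 * Real.pi * dot (fun j => k (i.succAbove j)) y + c) :=
    fun t => by ring
  simp_rw [this, integral_unitInterval_cos hk, mul_zero]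

lemma integral_cos_dot_eq_zero {d : ℕ} {k : Fin d → ℤ} (hk : k ≠ 0) (c : ℝ) :
    ∫ x : Cube d, Real.cos (2 * Real.pi * dot k x + c) = 0 := by
  obtain ⟨i, hi⟩ := Function.ne_iff.1 hk
  simpa using integral_mul_cos_eq_zero (g := fun _ => 1) (fun _ _ => rfl) hi c

open Classical in
/-- The phase which turns the cosine into `trig k`. -/
def phase {d : ℕ} (k : Fin d → ℤ) : ℝ := if FirstNonzeroPos k then 0 else -(Real.pi / 2)

lemma trig_eq_cos {d : ℕ} {k : Fin d → ℤ} (hk : k ≠ 0) (x : Cube d) :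
    trig k x = √2 * Real.cos (2 * Real.pi * dot k x + phase k) := by
  unfold trig phase
  rw [if_neg hk]
  split_ifs
  · simp
  · rw [← sub_eq_add_neg, Real.cos_sub_pi_div_two]

/-- The sign of the first nonzero coordinate decides, and negation flips it. Hence exactly one of ±k
carries the cosine, which is what makes the waves of k and -k orthogonal. -/
lemma firstNonzeroPos_neg_iff {d : ℕ} {k : Fin d → ℤ} (hk : k ≠ 0) :
    FirstNonzeroPos (-k) ↔ ¬ FirstNonzeroPos k := by
  constructor
  · rintro ⟨i, hi, hi'⟩ ⟨j, hj, hj'⟩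
    simp only [Pi.neg_apply] at hi hi'
    rcases lt_trichotomy i j with h | h | h
    · have := hj' i h; omega
    · subst h; omega
    · have := hi' j h; omega
  · intro h
    have hex : ∃ i, k i ≠ 0 := Function.ne_iff.1 hk
    obtain ⟨i, hi, hmin⟩ := WellFounded.has_min (wellFounded_lt (α := Fin d)) {i | k i ≠ 0} hex
    have hz : ∀ j < i, k j = 0 := fun j hj => by
      by_contra hne
      exact hmin j hne hj
    refine ⟨i, ?_, fun j hj => by simp [hz j hj]⟩
    have h1 : ¬ 0 < k i := fun hpos => h ⟨i, hpos, hz⟩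
    have h2 : k i ≠ 0 := hi
    simp only [Pi.neg_apply]
    omega

lemma dot_add {d : ℕ} (k l : Fin d → ℤ) (x : Cube d) : dot (k + l) x = dot k x + dot l x := by
  unfold dot
  rw [← Finset.sum_add_distrib]
  exact Finset.sum_congr rfl fun i _ => by push_cast [Pi.add_apply]; ring

lemma dot_sub {d : ℕ} (k l : Fin d → ℤ) (x : Cube d) : dot (k - l) x = dot k x - dot l x := by
  unfold dot
  rw [← Finset.sum_sub_distrib]
  exact Finset.sum_congr rfl fun i _ => by push_cast [Pi.sub_apply]; ring

/-- Product-to-sum leaves waves of frequencies k + l and k - l, and a wave of nonzero frequency has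
mean zero. For l = -k the surviving constant is the cosine of the sum of the two phases, that is
cos(-π/2) = 0. -/
lemma integral_trig_mul_trig {d : ℕ} (k l : Fin d → ℤ) :
    ∫ x : Cube d, trig k x * trig l x = if k = l then 1 else 0 := by
  by_cases hk : k = 0
  · by_cases hl : l = 0
    · subst hk; subst hl; simp [trig]
    · rw [if_neg (by rw [hk]; exact fun h => hl h.symm)]
      simp_rw [trig_eq_cos hl, hk]
      simp only [trig, if_true, one_mul]
      rw [integral_const_mul, integral_cos_dot_eq_zero hl, mul_zero]
  by_cases hl : l = 0
  · rw [if_neg (by rw [hl]; exact hk)]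
    simp_rw [trig_eq_cos hk, hl]
    simp only [trig, if_true, mul_one]
    rw [integral_const_mul, integral_cos_dot_eq_zero hk, mul_zero]
  have hprod : ∀ x : Cube d, trig k x * trig l x
      = Real.cos (2 * Real.pi * dot (k + l) x + (phase k + phase l))
        + Real.cos (2 * Real.pi * dot (k - l) x + (phase k - phase l)) := by
    intro x
    rw [trig_eq_cos hk, trig_eq_cos hl, dot_add, dot_sub]
    set a := 2 * Real.pi * dot k x + phase k with ha
    set b := 2 * Real.pi * dot l x + phase l with hb
    rw [show 2 * Real.pi * (dot k x + dot l x) + (phase k + phase l) = a + b by rw [ha, hb]; ring,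
      show 2 * Real.pi * (dot k x - dot l x) + (phase k - phase l) = a - b by rw [ha, hb]; ring,
      Real.cos_add a b, Real.cos_sub a b]
    have := Real.mul_self_sqrt (show (0 : ℝ) ≤ 2 by norm_num)
    linear_combination Real.cos a * Real.cos b * this
  have hint : ∀ (m : Fin d → ℤ) (c : ℝ),
      Integrable (fun x : Cube d => Real.cos (2 * Real.pi * dot m x + c)) := fun m c => by
    have := continuous_dot m
    exact Continuous.integrable_of_hasCompactSupport (by fun_prop) (HasCompactSupport.of_compactSpace _)
  simp_rw [hprod]
  rw [integral_add (hint _ _) (hint _ _)]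
  have h0 : ∀ c : ℝ, ∫ x : Cube d, Real.cos (2 * Real.pi * dot (0 : Fin d → ℤ) x + c)
      = Real.cos c := fun c => by simp [dot]
  split_ifs with hkl
  · subst hkl
    rw [sub_self, sub_self, h0, Real.cos_zero, integral_cos_dot_eq_zero, zero_add]
    intro h
    refine hk (funext fun i => ?_)
    have := congrFun h i
    simp only [Pi.add_apply, Pi.zero_apply] at this ⊢
    omega
  · rw [integral_cos_dot_eq_zero (sub_ne_zero.2 hkl), add_zero]
    by_cases h : k + l = 0
    · have hl' : l = -k := by rw [eq_neg_iff_add_eq_zero, add_comm]; exact h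
      rw [h, h0, hl']
      have := firstNonzeroPos_neg_iff hk
      unfold phase
      by_cases hf : FirstNonzeroPos k
      · rw [if_pos hf, if_neg (by tauto)]; simp
      · rw [if_neg hf, if_pos (by tauto)]; simp
    · exact integral_cos_dot_eq_zero h _

/-- The Fourier coefficients of a function of `x_J` vanish off the frequencies supported in `J`. -/
lemma theta_eq_zero_of_sparse {d : ℕ} {f : Cube d → ℝ} {J : Finset (Fin d)}
    (hf : ∃ fbar : (J → unitInterval) → ℝ, ∀ x : Cube d, f x = fbar (fun j => x j))
    {k : Fin d → ℤ} {i : Fin d} (hi : i ∉ J) (hk : k i ≠ 0) : theta f k = 0 := by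
  obtain ⟨fbar, hfbar⟩ := hf
  have hk0 : k ≠ 0 := fun h => hk (by simp [h])
  unfold theta
  simp_rw [trig_eq_cos hk0, mul_left_comm _ (√2)]
  rw [integral_const_mul, integral_mul_cos_eq_zero (i := i) _ hk, mul_zero]
  intro x t
  rw [hfbar, hfbar]
  congr 1
  funext j
  rw [Function.update_of_ne]
  rintro rfl
  exact hi j.2

/-- `trig k` as an element of `L²`. -/
def trigLp {d : ℕ} (k : Fin d → ℤ) : TestSpace d := (memLp_trig k).toLp (trig k)

lemma coeFn_trigLp {d : ℕ} (k : Fin d → ℤ) : trigLp k =ᵐ[volume] trig k := (memLp_trig k).coeFn_toLp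

lemma integral_mul_trigLp {d : ℕ} (f : Cube d → ℝ) (k : Fin d → ℤ) :
    ∫ x, f x * trigLp k x = theta f k :=
  integral_congr_ae <| by
    filter_upwards [coeFn_trigLp k] with x hx
    rw [hx]

lemma integral_trigLp_mul_trigLp {d : ℕ} (k l : Fin d → ℤ) :
    ∫ x : Cube d, trigLp k x * trigLp l x = if k = l then 1 else 0 := by
  rw [← integral_trig_mul_trig]
  refine integral_congr_ae ?_
  filter_upwards [coeFn_trigLp k, coeFn_trigLp l] with x hx hx'
  rw [hx, hx']

/-! ### Exponential moments of chi-square variables. -/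

open scoped NNReal

/-- Tilting a Gaussian density by `exp (a x²)` gives a multiple of a Gaussian density. -/
lemma gaussianPDFReal_mul_exp_sq (θ : ℝ) {v : ℝ≥0} (hv : v ≠ 0) {a : ℝ} (ha : 2 * a * v < 1)
    (x : ℝ) :
    gaussianPDFReal θ v x * Real.exp (a * x ^ 2)
      = ((√(1 - 2 * a * v))⁻¹ * Real.exp (a * θ ^ 2 / (1 - 2 * a * v)))
        * gaussianPDFReal (θ / (1 - 2 * a * v)) (v / (1 - 2 * a * v).toNNReal) x := by
  have hb : 0 < 1 - 2 * a * v := by linarith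
  have hv' : 0 < (v : ℝ) := by positivity
  unfold gaussianPDFReal
  rw [NNReal.coe_div, Real.coe_toNNReal _ hb.le]
  generalize hbdef : 1 - 2 * a * (v : ℝ) = b at *
  have hsq : √(2 * Real.pi * (v / b)) = √(2 * Real.pi * v) / √b := by
    rw [← mul_div_assoc, Real.sqrt_div' _ hb.le]
  have hexp : -(x - θ) ^ 2 / (2 * v) + a * x ^ 2
      = a * θ ^ 2 / b + -(x - θ / b) ^ 2 / (2 * (v / b)) := by
    field_simp
    have : a * (2 * v) = 1 - b := by linarith
    linear_combination (b * x ^ 2 - θ ^ 2) * this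
  have h1 : √b ≠ 0 := (Real.sqrt_pos.2 hb).ne'
  have h2 : √(2 * Real.pi * v) ≠ 0 := by positivity
  rw [hsq, mul_assoc, ← Real.exp_add, hexp, Real.exp_add]
  field_simp

lemma integrable_exp_sq_gaussianReal (θ : ℝ) {v : ℝ≥0} (hv : v ≠ 0) {a : ℝ}
    (ha : 2 * a * v < 1) : Integrable (fun x => Real.exp (a * x ^ 2)) (gaussianReal θ v) := by
  rw [gaussianReal_of_var_ne_zero _ hv,
    integrable_withDensity_iff (measurable_gaussianPDF _ _) (ae_of_all _ fun _ => gaussianPDF_lt_top)]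
  simp_rw [toReal_gaussianPDF, mul_comm (Real.exp _), gaussianPDFReal_mul_exp_sq θ hv ha]
  exact (integrable_gaussianPDFReal _ _).const_mul _

lemma integral_exp_sq_gaussianReal (θ : ℝ) {v : ℝ≥0} (hv : v ≠ 0) {a : ℝ}
    (ha : 2 * a * v < 1) :
    ∫ x, Real.exp (a * x ^ 2) ∂gaussianReal θ v
      = (√(1 - 2 * a * v))⁻¹ * Real.exp (a * θ ^ 2 / (1 - 2 * a * v)) := by
  have hb : 0 < 1 - 2 * a * v := by linarith
  rw [integral_gaussianReal_eq_integral_smul hv]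
  simp_rw [smul_eq_mul, gaussianPDFReal_mul_exp_sq θ hv ha]
  rw [integral_const_mul, integral_gaussianPDFReal_eq_one, mul_one]
  exact div_ne_zero hv (by simpa using hb)

lemma inv_sqrt_le_exp {b c : ℝ} (hb : 0 < b) (h : Real.exp (-(2 * c)) ≤ b) :
    (√b)⁻¹ ≤ Real.exp c := by
  rw [inv_le_comm₀ (Real.sqrt_pos.2 hb) (Real.exp_pos _), ← Real.exp_neg]
  refine Real.le_sqrt_of_sq_le ?_
  rw [← Real.exp_nat_mul]
  convert h using 2
  push_cast; ring

/-- Upper bound on the exponential moment of a centred chi-square variable. -/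
lemma integral_exp_sq_gaussianReal_zero_le {v : ℝ≥0} (hv : v ≠ 0) {a : ℝ} (ha0 : 0 ≤ a)
    (ha : a * v ≤ 1 / 4) :
    ∫ x, Real.exp (a * x ^ 2) ∂gaussianReal 0 v ≤ Real.exp (a * v + 2 * (a * v) ^ 2) := by
  have hu0 : 0 ≤ a * v := by positivity
  rw [integral_exp_sq_gaussianReal 0 hv (by linarith)]
  simp only [ne_eq, OfNat.ofNat_ne_zero, not_false_eq_true, zero_pow, mul_zero, zero_div,
    Real.exp_zero, mul_one]
  generalize hu : a * (v : ℝ) = u at *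
  rw [show 1 - 2 * a * (v : ℝ) = 1 - 2 * u by rw [← hu]; ring]
  have hpos : 0 < 1 - 2 * u := by linarith
  refine inv_sqrt_le_exp hpos ?_
  rw [Real.exp_neg, inv_le_comm₀ (Real.exp_pos _) hpos]
  -- The claim is now 1/(1 - 2u) ≤ exp(2u + 4u²); for u ≤ 1/4 the second-order Taylor polynomial of
  -- exp already suffices.
  refine le_trans ?_ (Real.quadratic_le_exp_of_nonneg (by positivity))
  rw [inv_le_iff_one_le_mul₀ hpos]
  have h2 := mul_nonneg (sq_nonneg u) (show 0 ≤ 1 / 4 - u by linarith)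
  have h3 := mul_nonneg (mul_nonneg (sq_nonneg u) hu0) (show 0 ≤ 1 / 4 - u by linarith)
  have h4 := mul_nonneg (mul_nonneg (sq_nonneg u) (sq_nonneg u)) (show 0 ≤ 1 / 4 - u by linarith)
  nlinarith

/-- Lower deviations: bound on the Laplace transform of a noncentral chi-square variable. -/
lemma integral_exp_neg_sq_gaussianReal_le (θ : ℝ) {v : ℝ≥0} (hv : v ≠ 0) {a : ℝ} (ha0 : 0 ≤ a) :
    ∫ x, Real.exp (-a * x ^ 2) ∂gaussianReal θ v
      ≤ Real.exp (-a * v - a * θ ^ 2 + (a * v) ^ 2 + 2 * (a * v) * (a * θ ^ 2)) := by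
  have hu0 : 0 ≤ a * v := by positivity
  rw [integral_exp_sq_gaussianReal θ hv (by linarith)]
  have hw0 : 0 ≤ a * θ ^ 2 := by positivity
  rw [show -a * θ ^ 2 = -(a * θ ^ 2) by ring, show -a * (v : ℝ) = -(a * v) by ring,
    show 1 - 2 * -a * (v : ℝ) = 1 + 2 * (a * v) by ring]
  generalize a * (v : ℝ) = u at *
  generalize a * θ ^ 2 = w at *
  have hpos : 0 < 1 + 2 * u := by linarith
  have h1 : (√(1 + 2 * u))⁻¹ ≤ Real.exp (-u + u ^ 2) := by
    refine inv_sqrt_le_exp hpos ?_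
    rw [show -(2 * (-u + u ^ 2)) = 2 * u - 2 * u ^ 2 by ring]
    have h3 : 2 * u - 2 * u ^ 2 ≤ Real.log (1 + 2 * u) := by
      refine le_trans ?_ (Real.le_log_one_add_of_nonneg (x := 2 * u) (by linarith))
      rw [le_div_iff₀ (by linarith)]
      nlinarith [mul_nonneg hu0 (sq_nonneg u)]
    rwa [← Real.le_log_iff_exp_le hpos]
  have h2 : -w / (1 + 2 * u) ≤ -w + 2 * u * w := by
    rw [div_le_iff₀ hpos]
    nlinarith [mul_nonneg hw0 (sq_nonneg u)]
  calc (√(1 + 2 * u))⁻¹ * Real.exp (-w / (1 + 2 * u))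
      ≤ Real.exp (-u + u ^ 2) * Real.exp (-w + 2 * u * w) := by gcongr
    _ = _ := by rw [← Real.exp_add]; congr 1; ring

/-! ### Empirical Fourier coefficients and tails of their energy. -/

/-- Under the white noise law the Fourier coefficients are observed with Gaussian errors. -/
lemma IsWhiteNoiseLaw.map_trigLp {d n : ℕ} {f : Cube d → ℝ} {P : Measure (Observation d)}
    (h : IsWhiteNoiseLaw n f P) (k : Fin d → ℤ) :
    P.map (fun Y => Y (trigLp k)) = gaussianReal (theta f k) (1 / (n : ℝ≥0)) := by
  have h1 := (h.gaussian.hasGaussianLaw_eval (trigLp k)).map_eq_gaussianReal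
  rw [h.mean, integral_mul_trigLp, ← covariance_self (measurable_pi_apply _).aemeasurable,
    h.cov, integral_trigLp_mul_trigLp, if_pos rfl] at h1
  rw [h1]
  congr 1
  ext
  simp

/-- The coefficients are jointly Gaussian, and orthonormality makes them uncorrelated. -/
lemma IsWhiteNoiseLaw.iIndepFun_trigLp {d n : ℕ} {f : Cube d → ℝ} {P : Measure (Observation d)}
    (h : IsWhiteNoiseLaw n f P) :
    iIndepFun (fun (k : Fin d → ℤ) (Y : Observation d) => Y (trigLp k)) P := by
  have := h.gaussian.isProbabilityMeasure
  rw [iIndepFun_iff_finset]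
  intro s
  refine HasGaussianLaw.iIndepFun_of_covariance_eq_zero
    ((h.gaussian.comp_right trigLp).hasGaussianLaw s) fun k l hkl => ?_
  refine (h.cov (trigLp k) (trigLp l)).trans ?_
  rw [integral_trigLp_mul_trigLp, if_neg (fun h' => hkl (Subtype.ext h')), mul_zero]

/-- The sum of the squared empirical coefficients over a set of frequencies. -/
def energyStat {d : ℕ} (K : Finset (Fin d → ℤ)) (Y : Observation d) : ℝ :=
  ∑ k ∈ K, Y (trigLp k) ^ 2

lemma IsWhiteNoiseLaw.mgf_energyStat {d n : ℕ} (hn : n ≠ 0) {f : Cube d → ℝ}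
    {P : Measure (Observation d)} (h : IsWhiteNoiseLaw n f P) (K : Finset (Fin d → ℤ)) {a : ℝ}
    (ha : 2 * a * (1 / (n : ℝ≥0) : ℝ≥0) < 1) :
    Integrable (fun Y => Real.exp (a * energyStat K Y)) P ∧
    mgf (energyStat K) P a
      = ∏ k ∈ K, ∫ x, Real.exp (a * x ^ 2) ∂gaussianReal (theta f k) (1 / (n : ℝ≥0)) := by
  have hP := h.gaussian.isProbabilityMeasure
  have hv : (1 / (n : ℝ≥0)) ≠ 0 := by positivity
  have hind : iIndepFun (fun (k : Fin d → ℤ) (Y : Observation d) => Y (trigLp k) ^ 2) P :=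
    h.iIndepFun_trigLp.comp (fun _ x => x ^ 2) fun _ => by fun_prop
  have hm : ∀ k : Fin d → ℤ, Measurable fun Y : Observation d => Y (trigLp k) ^ 2 :=
    fun k => (measurable_pi_apply _).pow_const 2
  have hfun : energyStat K
      = ∑ k ∈ K, fun Y : Observation d => Y (trigLp k) ^ 2 := by
    ext Y; simp [energyStat]
  have hmeas : ∀ k : Fin d → ℤ, AEMeasurable (fun Y : Observation d => Y (trigLp k)) P :=
    fun k => (measurable_pi_apply _).aemeasurable
  constructor
  · rw [hfun]
    refine hind.integrable_exp_mul_sum hm fun k _ => ?_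
    have := integrable_exp_sq_gaussianReal (theta f k) hv ha
    rw [← h.map_trigLp k] at this
    exact this.comp_aemeasurable (hmeas k)
  · rw [hfun, hind.mgf_sum hm]
    refine Finset.prod_congr rfl fun k _ => ?_
    rw [← h.map_trigLp k, integral_map (hmeas k) (by fun_prop)]
    rfl

/-- Upper tail of the energy statistic over frequencies which carry no signal. -/
lemma IsWhiteNoiseLaw.energyStat_ge_le {d n : ℕ} (hn : n ≠ 0) {f : Cube d → ℝ}
    {P : Measure (Observation d)} (h : IsWhiteNoiseLaw n f P) {K : Finset (Fin d → ℤ)}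
    (hK : ∀ k ∈ K, theta f k = 0) {u : ℝ} (hu0 : 0 ≤ u) (hu : u ≤ 1 / 4) (t : ℝ) :
    P.real {Y | t + K.card / n ≤ energyStat K Y}
      ≤ Real.exp (-u * (n * t) + 2 * u ^ 2 * K.card) := by
  have hP := h.gaussian.isProbabilityMeasure
  have hn' : (n : ℝ) ≠ 0 := by exact_mod_cast hn
  have hv : (1 / (n : ℝ≥0)) ≠ 0 := by positivity
  have hnu : n * u * (1 / (n : ℝ≥0) : ℝ≥0) = u := by push_cast; field_simp
  obtain ⟨hint, hmgf⟩ := h.mgf_energyStat hn K (a := n * u) (by linarith)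
  refine (measure_ge_le_exp_mul_mgf _ (by positivity) hint).trans ?_
  have hb : mgf (energyStat K) P (n * u) ≤ Real.exp (u + 2 * u ^ 2) ^ K.card := by
    rw [hmgf]
    rw [← Finset.prod_const]
    refine Finset.prod_le_prod (fun k hk => integral_nonneg fun x => (Real.exp_pos _).le)
      (fun k hk => ?_)
    rw [hK k hk]
    refine (integral_exp_sq_gaussianReal_zero_le hv (by positivity) (by linarith)).trans
      (le_of_eq ?_)
    rw [hnu]
  refine (mul_le_mul_of_nonneg_left hb (Real.exp_pos _).le).trans (le_of_eq ?_)
  rw [← Real.exp_nat_mul, ← Real.exp_add]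
  congr 1
  field_simp
  ring

/-- Lower tail of the energy statistic. -/
lemma IsWhiteNoiseLaw.energyStat_le_le {d n : ℕ} (hn : n ≠ 0) {f : Cube d → ℝ}
    {P : Measure (Observation d)} (h : IsWhiteNoiseLaw n f P) (K : Finset (Fin d → ℤ))
    {u : ℝ} (hu0 : 0 ≤ u) (t : ℝ) :
    P.real {Y | energyStat K Y ≤ t + K.card / n}
      ≤ Real.exp (-u * (n * (∑ k ∈ K, theta f k ^ 2 - t)) + u ^ 2 * K.card
        + 2 * u ^ 2 * (n * ∑ k ∈ K, theta f k ^ 2)) := by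
  have hP := h.gaussian.isProbabilityMeasure
  have hn' : (n : ℝ) ≠ 0 := by exact_mod_cast hn
  have hv : (1 / (n : ℝ≥0)) ≠ 0 := by positivity
  have hnu : n * u * (1 / (n : ℝ≥0) : ℝ≥0) = u := by push_cast; field_simp
  obtain ⟨hint, hmgf⟩ := h.mgf_energyStat hn K (a := -(n * u)) (by linarith)
  refine (measure_le_le_exp_mul_mgf _ (by simp; positivity) hint).trans ?_
  have hb : mgf (energyStat K) P (-(n * u))
      ≤ ∏ k ∈ K, Real.exp (-u - n * u * theta f k ^ 2 + u ^ 2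
        + 2 * u * (n * u * theta f k ^ 2)) := by
    rw [hmgf]
    refine Finset.prod_le_prod (fun k hk => integral_nonneg fun x => (Real.exp_pos _).le)
      (fun k hk => ?_)
    refine (integral_exp_neg_sq_gaussianReal_le _ hv (by positivity)).trans (le_of_eq ?_)
    rw [neg_mul, hnu]
  refine (mul_le_mul_of_nonneg_left hb (Real.exp_pos _).le).trans (le_of_eq ?_)
  rw [← Real.exp_sum, ← Real.exp_add]
  congr 1
  simp_rw [Finset.sum_add_distrib, Finset.sum_sub_distrib, ← Finset.mul_sum, Finset.sum_const,
    nsmul_eq_mul]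
  field_simp
  ring

/-! ### Low frequencies: Sobolev tail and lattice point count. -/

/-- The frequencies supported in `J` with squared Euclidean norm at most `m`. -/
def freqBall {d : ℕ} (J : Finset (Fin d)) (m : ℝ) : Finset (Fin d → ℤ) :=
  (Fintype.piFinset fun i => if i ∈ J then Finset.Icc (-⌊m⌋) ⌊m⌋ else {0}).filter
    fun k => ∑ i ∈ J, (k i : ℝ) ^ 2 ≤ m

/-- Integers satisfy |k_i| ≤ k_i², so the cube of half-side ⌊m⌋ contains the ball; it only supplies
finiteness. -/
lemma mem_freqBall {d : ℕ} {J : Finset (Fin d)} {m : ℝ} {k : Fin d → ℤ} :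
    k ∈ freqBall J m ↔ (∀ i ∉ J, k i = 0) ∧ ∑ i ∈ J, (k i : ℝ) ^ 2 ≤ m := by
  unfold freqBall
  rw [Finset.mem_filter, Fintype.mem_piFinset]
  refine and_congr_left fun hm => ⟨fun h i hi => by simpa [hi] using h i, fun h i => ?_⟩
  by_cases hi : i ∈ J
  · rw [if_pos hi, Finset.mem_Icc, ← abs_le, Int.le_floor]
    have h1 : (k i : ℝ) ^ 2 ≤ m :=
      (Finset.single_le_sum (f := fun i => (k i : ℝ) ^ 2) (fun j _ => sq_nonneg _) hi).trans hm
    refine le_trans ?_ h1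
    have h2 : |k i| ≤ (k i) ^ 2 := by
      rw [← sq_abs]
      rcases eq_or_ne (k i) 0 with h0 | h0
      · simp [h0]
      · have := Int.one_le_abs h0
        nlinarith
    exact_mod_cast h2
  · simpa [hi] using h i hi

/-- The energy of `f` in the direction `j ∈ J` is captured by the low frequencies, up to a
Sobolev tail. -/
lemma le_sum_theta_sq {d dstar : ℕ} {κ L m : ℝ} (hL : 0 ≤ L) (hm : 0 < m) {f : Cube d → ℝ}
    {J : Finset (Fin d)} (hf : ConditionC1 κ L dstar f J) {j : Fin d} (hj : j ∈ J) :
    κ ≤ ∑ k ∈ (freqBall J m).filter (fun k => k j ≠ 0), theta f k ^ 2 + J.card * L / m := by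
  set K := (freqBall J m).filter (fun k => k j ≠ 0) with hK
  have key : Q f j ≤ ENNReal.ofReal (∑ k ∈ K, theta f k ^ 2 + J.card * L / m) := by
    -- A Markov-type bound, term by term: outside the ball Σ k_i²/m ≥ 1, and frequencies not
    -- supported in `J` carry no energy.
    have hpt : ∀ k : {k : Fin d → ℤ // k j ≠ 0}, ENNReal.ofReal (theta f k.1 ^ 2)
        ≤ (if k.1 ∈ K then ENNReal.ofReal (theta f k.1 ^ 2) else 0)
          + ENNReal.ofReal (1 / m) *
            ∑ i ∈ J, ENNReal.ofReal ((k.1 i : ℝ) ^ 2 * theta f k.1 ^ 2) := by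
      rintro ⟨k, hk⟩
      by_cases hkJ : ∀ i ∉ J, k i = 0
      · by_cases hkm : ∑ i ∈ J, (k i : ℝ) ^ 2 ≤ m
        · rw [if_pos (by rw [hK, Finset.mem_filter, mem_freqBall]; exact ⟨⟨hkJ, hkm⟩, hk⟩)]
          exact le_self_add
        · refine le_add_left ?_
          rw [← ENNReal.ofReal_sum_of_nonneg (fun i _ => by positivity),
            ← ENNReal.ofReal_mul (by positivity), ← Finset.sum_mul]
          refine ENNReal.ofReal_le_ofReal ?_
          rw [← mul_assoc]
          refine le_mul_of_one_le_left (sq_nonneg _) ?_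
          rw [one_div, inv_mul_eq_div, one_le_div hm]
          exact (not_le.1 hkm).le
      · push Not at hkJ
        obtain ⟨i, hi, hki⟩ := hkJ
        rw [theta_eq_zero_of_sparse hf.sparse hi hki]
        simp
    unfold Q
    refine (ENNReal.tsum_le_tsum hpt).trans ?_
    rw [ENNReal.tsum_add, ENNReal.tsum_mul_left, ENNReal.ofReal_add
      (Finset.sum_nonneg fun _ _ => sq_nonneg _) (by positivity)]
    refine add_le_add ?_ ?_
    · refine (ENNReal.tsum_comp_le_tsum_of_injective Subtype.val_injective
        (fun k : Fin d → ℤ => if k ∈ K then ENNReal.ofReal (theta f k ^ 2) else 0)).trans ?_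
      rw [tsum_eq_sum (s := K) (fun k hk => if_neg hk),
        ENNReal.ofReal_sum_of_nonneg (fun _ _ => sq_nonneg _)]
      exact (Finset.sum_congr rfl fun k hk => if_pos hk).le
    · rw [Summable.tsum_finsetSum (fun _ _ => ENNReal.summable)]
      have : ∀ i ∈ J, ∑' k : {k : Fin d → ℤ // k j ≠ 0},
          ENNReal.ofReal ((k.1 i : ℝ) ^ 2 * theta f k.1 ^ 2) ≤ ENNReal.ofReal L := fun i _ =>
        (ENNReal.tsum_comp_le_tsum_of_injective Subtype.val_injective
          (fun k : Fin d → ℤ => ENNReal.ofReal ((k i : ℝ) ^ 2 * theta f k ^ 2))).trans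
          (hf.sobolev.sum_le i)
      refine (mul_le_mul_right (Finset.sum_le_card_nsmul _ _ _ this) _).trans (le_of_eq ?_)
      rw [nsmul_eq_mul, ← ENNReal.ofReal_natCast, ← ENNReal.ofReal_mul (by positivity),
        ← ENNReal.ofReal_mul (by positivity)]
      congr 1
      ring
  exact (ENNReal.ofReal_le_ofReal_iff (by positivity)).1 ((hf.relevant j hj).trans key)

/-- The class is empty for `κ > L`. -/
lemma le_of_conditionC1 {d dstar : ℕ} {κ L : ℝ} (hL : 0 ≤ L) {f : Cube d → ℝ}
    {J : Finset (Fin d)} (hf : ConditionC1 κ L dstar f J) (hJ : J.Nonempty) : κ ≤ L := by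
  obtain ⟨j, hj⟩ := hJ
  refine (ENNReal.ofReal_le_ofReal_iff hL).1 ((hf.relevant j hj).trans ?_)
  refine le_trans ?_ (hf.sobolev.sum_le j)
  unfold Q
  refine le_trans (ENNReal.tsum_le_tsum fun k => ?_)
    (ENNReal.tsum_comp_le_tsum_of_injective Subtype.val_injective
      (fun k : Fin d → ℤ => ENNReal.ofReal ((k j : ℝ) ^ 2 * theta f k ^ 2)))
  refine ENNReal.ofReal_le_ofReal (le_mul_of_one_le_left (sq_nonneg _) ?_)
  have h1 : (1 : ℤ) ≤ (k.1 j) ^ 2 := by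
    have := Int.one_le_abs k.2
    rw [← sq_abs]
    nlinarith
  exact_mod_cast h1

/-- Telescoping: with w = q(z+1), (1 + qz)(1 + w) ≤ (1 + w)² ≤ 2(1 + w²), and 1/((1 + qz)(1 + w)) is
a difference quotient of 1/(1 + qz). -/
lemma sum_range_inv_one_add_sq_le {q : ℝ} (hq : 0 < q) (M : ℕ) :
    ∑ z ∈ Finset.range M, (1 + (q * (z + 1)) ^ 2)⁻¹ ≤ 2 / q := by
  have hterm : ∀ z : ℕ, (1 + (q * (z + 1)) ^ 2)⁻¹
      ≤ 2 / q * ((1 + q * z)⁻¹ - (1 + q * ((z + 1 : ℕ) : ℝ))⁻¹) := by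
    intro z
    have h0 : (0 : ℝ) ≤ q * z := by positivity
    have h1 : 0 < 1 + q * z := by linarith
    have h2 : 0 < 1 + q * (z + 1) := by positivity
    have h3 : 0 < 1 + (q * (z + 1)) ^ 2 := by positivity
    push_cast
    rw [inv_sub_inv h1.ne' h2.ne',
      show 2 / q * ((1 + q * (z + 1) - (1 + q * z)) / ((1 + q * z) * (1 + q * (z + 1))))
        = 2 / ((1 + q * z) * (1 + q * (z + 1))) by field_simp; ring,
      inv_eq_one_div, div_le_div_iff₀ h3 (by positivity)]
    nlinarith [sq_nonneg (1 - q * (z + 1)), mul_pos hq h2]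
  refine (Finset.sum_le_sum fun z _ => hterm z).trans ?_
  rw [← Finset.mul_sum]
  have := Finset.sum_range_sub' (fun z : ℕ => (1 + q * (z : ℝ))⁻¹) M
  rw [this]
  refine mul_le_of_le_one_right (by positivity) ?_
  have : 0 ≤ (1 + q * (M : ℝ))⁻¹ := by positivity
  simp
  positivity

lemma sum_Icc_inv_one_add_sq_le {q : ℝ} (hq : 0 < q) (hq1 : q ≤ 1) (M : ℤ) :
    ∑ z ∈ Finset.Icc (-M) M, (1 + q ^ 2 * (z : ℝ) ^ 2)⁻¹ ≤ 5 / q := by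
  have hsub : Finset.Icc (-M) M ⊆ {0} ∪ ((Finset.range M.toNat).image (fun z : ℕ => (z : ℤ) + 1)
      ∪ (Finset.range M.toNat).image (fun z : ℕ => -((z : ℤ) + 1))) := by
    intro z hz
    rw [Finset.mem_Icc] at hz
    simp only [Finset.mem_union, Finset.mem_singleton, Finset.mem_image, Finset.mem_range]
    rcases lt_trichotomy z 0 with h | h | h
    · exact Or.inr (Or.inr ⟨(-z - 1).toNat, by omega, by omega⟩)
    · exact Or.inl h
    · exact Or.inr (Or.inl ⟨(z - 1).toNat, by omega, by omega⟩)
  have hnn : ∀ z : ℤ, 0 ≤ (1 + q ^ 2 * (z : ℝ) ^ 2)⁻¹ := fun z => by positivity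
  have hu : ∀ s t : Finset ℤ, ∑ z ∈ s ∪ t, (1 + q ^ 2 * (z : ℝ) ^ 2)⁻¹
      ≤ ∑ z ∈ s, (1 + q ^ 2 * (z : ℝ) ^ 2)⁻¹ + ∑ z ∈ t, (1 + q ^ 2 * (z : ℝ) ^ 2)⁻¹ :=
    fun s t => by
      rw [← Finset.sum_union_inter]
      exact le_add_of_nonneg_right (Finset.sum_nonneg fun z _ => hnn z)
  refine (Finset.sum_le_sum_of_subset_of_nonneg hsub fun z _ _ => hnn z).trans ?_
  refine (hu _ _).trans ((add_le_add_right (hu _ _) _).trans ?_)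
  rw [Finset.sum_image (fun a _ b _ h => by simpa using h),
    Finset.sum_image (fun a _ b _ h => by simpa using h)]
  have h1 := sum_range_inv_one_add_sq_le hq M.toNat
  have e1 : ∀ z : ℕ, (1 + q ^ 2 * (((z : ℤ) + 1 : ℤ) : ℝ) ^ 2)⁻¹ = (1 + (q * (z + 1)) ^ 2)⁻¹ :=
    fun z => by push_cast; ring
  have e2 : ∀ z : ℕ, (1 + q ^ 2 * ((-((z : ℤ) + 1) : ℤ) : ℝ) ^ 2)⁻¹ = (1 + (q * (z + 1)) ^ 2)⁻¹ :=
    fun z => by push_cast; ring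
  simp_rw [e1, e2]
  have h2 : (1 : ℝ) ≤ 1 / q := by rw [one_le_div hq]; exact hq1
  have h3 : 5 / q = 1 / q + (2 / q + 2 / q) := by ring
  simp only [Finset.sum_singleton, Int.cast_zero]
  norm_num
  rw [h3]
  linarith

/-- The number of lattice points in a ball of radius comparable to the square root of the
dimension. -/
lemma card_freqBall_le {d : ℕ} (J : Finset (Fin d)) {q : ℝ} (hq : 0 < q) (hq1 : q ≤ 1) :
    ((freqBall J (J.card / q ^ 2)).card : ℝ) ≤ (15 / q) ^ J.card := by
  set m : ℝ := J.card / q ^ 2 with hm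
  have hw : ∀ k ∈ freqBall J m, 1 ≤ (3 : ℝ) ^ J.card * ∏ i ∈ J, (1 + q ^ 2 * (k i : ℝ) ^ 2)⁻¹ := by
    intro k hk
    rw [mem_freqBall] at hk
    rw [Finset.prod_inv_distrib, ← div_eq_mul_inv, one_le_div (Finset.prod_pos fun i _ => by
      positivity)]
    have h1 : ∏ i ∈ J, (1 + q ^ 2 * (k i : ℝ) ^ 2) ≤ Real.exp J.card := by
      refine (Finset.prod_le_prod (fun i _ => by positivity)
        (fun i _ => show 1 + q ^ 2 * (k i : ℝ) ^ 2 ≤ Real.exp (q ^ 2 * (k i : ℝ) ^ 2) by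
          rw [add_comm]; exact Real.add_one_le_exp _)).trans ?_
      rw [← Real.exp_sum, ← Finset.mul_sum]
      refine Real.exp_le_exp.2 ?_
      have := mul_le_mul_of_nonneg_left hk.2 (sq_nonneg q)
      rwa [hm, mul_div_cancel₀ _ (by positivity)] at this
    refine h1.trans ?_
    rw [show (J.card : ℝ) = J.card * 1 by ring, Real.exp_nat_mul]
    exact pow_le_pow_left₀ (Real.exp_pos _).le (Real.exp_one_lt_d9.le.trans (by norm_num)) _
  calc ((freqBall J m).card : ℝ) = ∑ k ∈ freqBall J m, 1 := by simp
    _ ≤ ∑ k ∈ freqBall J m, (3 : ℝ) ^ J.card * ∏ i ∈ J, (1 + q ^ 2 * (k i : ℝ) ^ 2)⁻¹ :=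
        Finset.sum_le_sum hw
    _ ≤ ∑ k ∈ Fintype.piFinset (fun i : Fin d => if i ∈ J then Finset.Icc (-⌊m⌋) ⌊m⌋ else {0}),
          (3 : ℝ) ^ J.card * ∏ i ∈ J, (1 + q ^ 2 * (k i : ℝ) ^ 2)⁻¹ := by
        refine Finset.sum_le_sum_of_subset_of_nonneg (Finset.filter_subset _ _) fun k _ _ => ?_
        have : 0 ≤ ∏ i ∈ J, (1 + q ^ 2 * (k i : ℝ) ^ 2)⁻¹ :=
          Finset.prod_nonneg fun i _ => by positivity
        positivity
    _ = (3 : ℝ) ^ J.card * ∏ i : Fin d,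
          ∑ z ∈ (if i ∈ J then Finset.Icc (-⌊m⌋) ⌊m⌋ else {0}),
            (if i ∈ J then (1 + q ^ 2 * (z : ℝ) ^ 2)⁻¹ else 1) := by
        rw [← Finset.mul_sum, Finset.prod_univ_sum]
        congr 1
        refine Finset.sum_congr rfl fun k _ => ?_
        rw [Finset.prod_ite_mem, Finset.univ_inter]
    _ = (3 : ℝ) ^ J.card * ∏ i ∈ J, ∑ z ∈ Finset.Icc (-⌊m⌋) ⌊m⌋, (1 + q ^ 2 * (z : ℝ) ^ 2)⁻¹ := by
        congr 1
        rw [← Finset.prod_subset (Finset.subset_univ J) (fun i _ hi => by simp [hi])]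
        exact Finset.prod_congr rfl fun i hi => by simp [hi]
    _ ≤ (3 : ℝ) ^ J.card * (5 / q) ^ J.card := by
        rw [Finset.prod_const]
        refine mul_le_mul_of_nonneg_left (pow_le_pow_left₀ (Finset.sum_nonneg fun z _ => by
          positivity) (sum_Icc_inv_one_add_sq_le hq hq1 _) _) (by positivity)
    _ = (15 / q) ^ J.card := by rw [← mul_pow]; ring_nf

/-! ### Entropy of patterns and the separation rate. -/

/-- `s log (e d / s)`, an upper bound on the logarithm of the number of patterns of size `s`. -/
def entropyBound (d s : ℕ) : ℝ := s * (1 + Real.log ((d : ℝ) / s))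

lemma log_div_nonneg {d s : ℕ} (hsd : s ≤ d) : 0 ≤ Real.log ((d : ℝ) / s) := by
  rcases Nat.eq_zero_or_pos s with rfl | hs
  · simp
  · exact Real.log_nonneg ((one_le_div (by positivity)).2 (by exact_mod_cast hsd))

lemma le_entropyBound {d s : ℕ} (hsd : s ≤ d) : (s : ℝ) ≤ entropyBound d s := by
  have := log_div_nonneg hsd
  unfold entropyBound
  nlinarith [(Nat.cast_nonneg s : (0 : ℝ) ≤ s)]

lemma choose_le_exp_entropyBound {d s : ℕ} (hs : 1 ≤ s) (hsd : s ≤ d) :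
    (d.choose s : ℝ) ≤ Real.exp (entropyBound d s) := by
  have hs' : (0 : ℝ) < s := by exact_mod_cast hs
  have hd' : (0 : ℝ) < d := by exact_mod_cast hs.trans hsd
  have h2 := Real.pow_div_factorial_le_exp (s : ℝ) hs'.le s
  calc (d.choose s : ℝ) ≤ (d : ℝ) ^ s / s.factorial := Nat.choose_le_pow_div s d
    _ = ((d : ℝ) / s) ^ s * ((s : ℝ) ^ s / s.factorial) := by rw [div_pow]; field_simp
    _ ≤ ((d : ℝ) / s) ^ s * Real.exp s := by gcongr
    _ = Real.exp (entropyBound d s) := by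
      unfold entropyBound
      rw [Real.exp_nat_mul, Real.exp_add, Real.exp_log (by positivity), mul_pow,
        ← Real.exp_nat_mul, mul_one, mul_comm]

/-- Since log s ≤ s - 1, the summand s of the entropy makes up for log d - log(d/s). Factors exp(-S)
can therefore pay for powers of d. -/
lemma log_le_entropyBound {d s : ℕ} (hs : 1 ≤ s) (hsd : s ≤ d) :
    Real.log d ≤ entropyBound d s := by
  have hs' : (1 : ℝ) ≤ s := by exact_mod_cast hs
  have hd' : (0 : ℝ) < d := by exact_mod_cast hs.trans hsd
  have h1 := log_div_nonneg hsd
  have h3 := Real.log_le_sub_one_of_pos (show (0 : ℝ) < s by linarith)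
  have h4 : Real.log d = Real.log ((d : ℝ) / s) + Real.log s := by
    rw [Real.log_div hd'.ne' (by positivity)]; ring
  unfold entropyBound
  rw [h4]
  nlinarith

/-- The union bound over all patterns. -/
lemma sum_card_mul_exp_le {d : ℕ} (hd : 1 ≤ d) :
    ∑ J : Finset (Fin d), (J.card : ℝ) * Real.exp (-6 * entropyBound d J.card) ≤ 2 / d := by
  have hd' : (1 : ℝ) ≤ d := by exact_mod_cast hd
  have h := Finset.sum_powerset_apply_card (x := (Finset.univ : Finset (Fin d)))
    (fun r => (r : ℝ) * Real.exp (-6 * entropyBound d r))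
  rw [Finset.powerset_univ] at h
  rw [h, Finset.card_univ, Fintype.card_fin]
  -- Of the six entropies in the exponent, one pays for the number of patterns of size `r` and one
  -- for the factor `r`; the other four exceed 2 log d.
  have hterm : ∀ r ∈ Finset.range (d + 1),
      d.choose r • ((r : ℝ) * Real.exp (-6 * entropyBound d r)) ≤ 1 / (d : ℝ) ^ 2 := by
    intro r hr
    rcases Nat.eq_zero_or_pos r with rfl | hr0
    · simp
    have hrd : r ≤ d := by rw [Finset.mem_range] at hr; omega
    have h1 := choose_le_exp_entropyBound hr0 hrd
    have h2 : (r : ℝ) ≤ Real.exp (entropyBound d r) :=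
      (le_entropyBound hrd).trans (by linarith [Real.add_one_le_exp (entropyBound d r)])
    have h3 := log_le_entropyBound hr0 hrd
    rw [nsmul_eq_mul]
    calc (d.choose r : ℝ) * (r * Real.exp (-6 * entropyBound d r))
        ≤ Real.exp (entropyBound d r)
          * (Real.exp (entropyBound d r) * Real.exp (-6 * entropyBound d r)) := by gcongr
      _ = Real.exp (-4 * entropyBound d r) := by
          rw [← Real.exp_add, ← Real.exp_add]; ring_nf
      _ ≤ Real.exp (-(2 * Real.log d)) := by
          refine Real.exp_le_exp.2 ?_
          linarith [Real.log_nonneg hd']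
      _ = 1 / (d : ℝ) ^ 2 := by
          rw [Real.exp_neg, two_mul, Real.exp_add, Real.exp_log (by linarith), sq, one_div]
  refine (Finset.sum_le_card_nsmul _ _ _ hterm).trans ?_
  rw [Finset.card_range, nsmul_eq_mul, mul_one_div, div_le_div_iff₀ (by positivity) (by positivity)]
  push_cast
  nlinarith

/-- Applied with y² = κ/D, it replaces the fractional exponent of the rate by the integer power
y^(4+s). -/
lemma rpow_le_sq_iff {X y : ℝ} (hX : 0 ≤ X) (hy : 0 ≤ y) (s : ℕ) :
    X ^ ((2 : ℝ) / (4 + s)) ≤ y ^ 2 ↔ X ≤ y ^ (4 + s) := by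
  have h : y ^ 2 = (y ^ (4 + s)) ^ ((2 : ℝ) / (4 + s)) := by
    rw [← Real.rpow_natCast y (4 + s), ← Real.rpow_mul hy]
    push_cast
    rw [mul_div_cancel₀ _ (by positivity)]
    norm_num
  rw [h]
  exact Real.rpow_le_rpow_iff hX (pow_nonneg hy _) (by positivity)

lemma sq_le_rpow_iff {X y : ℝ} (hX : 0 ≤ X) (hy : 0 ≤ y) (s : ℕ) :
    y ^ 2 ≤ X ^ ((2 : ℝ) / (4 + s)) ↔ y ^ (4 + s) ≤ X := by
  have h : y ^ 2 = (y ^ (4 + s)) ^ ((2 : ℝ) / (4 + s)) := by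
    rw [← Real.rpow_natCast y (4 + s), ← Real.rpow_mul hy]
    push_cast
    rw [mul_div_cancel₀ _ (by positivity)]
    norm_num
  rw [h]
  exact Real.rpow_le_rpow_iff (pow_nonneg hy _) hX (by positivity)

/-- From log x ≥ 1 - 1/x and d ≥ s + 1. It controls the regime where d/s is close to 1 and the
logarithm is small. -/
lemma one_div_two_mul_le_log_div {d s : ℕ} (hs : 1 ≤ s) (hsd : s < d) :
    1 / (2 * (s : ℝ)) ≤ Real.log ((d : ℝ) / s) := by
  have hs' : (1 : ℝ) ≤ s := by exact_mod_cast hs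
  have hd' : (s : ℝ) + 1 ≤ d := by exact_mod_cast hsd
  have h1 := Real.one_sub_inv_le_log_of_pos (show 0 < (d : ℝ) / s by
    apply div_pos <;> linarith)
  refine le_trans ?_ h1
  rw [inv_div, one_sub_div (by linarith), div_le_div_iff₀ (by linarith) (by linarith)]
  nlinarith

set_option maxHeartbeats 1000000 in
/-- Above the separation rate, both the entropy and the product of the entropy with the number of
frequencies are small compared with the signal. -/
lemma entropyBound_le_of_rate_le {L κ : ℝ} (hL : 0 < L) {n d s : ℕ} (hn : 1 ≤ n) (hs : 1 ≤ s)
    (hsd : s < d) (hκL : κ ≤ L) (hrate : 4096 * (1 + 450 * L) * rate n d s ≤ κ) :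
    0 < κ ∧ 1024 * entropyBound d s ≤ n * κ ∧
      1024 * ((15 / √(κ / (2 * L))) ^ s * entropyBound d s) ≤ (n * κ) ^ 2 := by
  set D : ℝ := 4096 * (1 + 450 * L) with hD
  set ℓ : ℝ := Real.log ((d : ℝ) / s) with hℓ
  have hs' : (1 : ℝ) ≤ s := by exact_mod_cast hs
  have hn' : (1 : ℝ) ≤ n := by exact_mod_cast hn
  have hn0 : (0 : ℝ) < n := by linarith
  have hℓ1 : 1 / (2 * (s : ℝ)) ≤ ℓ := one_div_two_mul_le_log_div hs hsd
  have hℓ2 : 1 ≤ 2 * s * ℓ := by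
    rw [div_le_iff₀ (by positivity)] at hℓ1; linarith
  have hℓ0 : 0 < ℓ := lt_of_lt_of_le (by positivity) hℓ1
  have hD0 : 4096 ≤ D := by rw [hD]; linarith
  have hDpos : 0 < D := by linarith
  have hr1 : D * (s * ℓ / n) ≤ κ :=
    le_trans (mul_le_mul_of_nonneg_left (le_max_right _ _) hDpos.le) hrate
  have hκ : 0 < κ := lt_of_lt_of_le (by positivity) hr1
  have hr2 : D * (ℓ / (n : ℝ) ^ 2) ^ ((2 : ℝ) / (4 + s)) ≤ κ :=
    le_trans (mul_le_mul_of_nonneg_left (le_max_left _ _) hDpos.le) hrate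
  set y : ℝ := √(κ / D) with hy
  have hy0 : 0 < y := Real.sqrt_pos.2 (by positivity)
  have hy2 : y ^ 2 = κ / D := Real.sq_sqrt (by positivity)
  have hX : ℓ / (n : ℝ) ^ 2 ≤ y ^ (4 + s) := by
    rw [← rpow_le_sq_iff (by positivity) hy0.le, hy2, le_div_iff₀ hDpos, mul_comm]
    exact hr2
  have hX' : ℓ * D ^ 2 * (1 / y) ^ s ≤ (n * κ) ^ 2 := by
    rw [div_le_iff₀ (by positivity)] at hX
    have hκy : κ = y ^ 2 * D := by rw [hy2]; field_simp
    calc ℓ * D ^ 2 * (1 / y) ^ s ≤ (y ^ (4 + s) * n ^ 2) * D ^ 2 * (1 / y) ^ s := by gcongr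
      _ = (n * κ) ^ 2 := by
          rw [hκy, pow_add, one_div, inv_pow]
          field_simp
  have hyL : 64 ≤ 1 / y := by
    rw [le_div_iff₀ hy0]
    refine (Real.abs_le_sqrt (x := 64 * y) (y := 1) ?_ |> le_trans (le_abs_self _)).trans (by simp)
    rw [mul_pow, hy2, ← mul_div_assoc, div_le_one hDpos, hD]
    linarith
  -- The constant 450 = 2·15² in `D` serves here: it leaves a spare factor 64^s beyond the frequency
  -- count, which will absorb powers of `s`.
  have hyq : 64 * (15 / √(κ / (2 * L))) ≤ 1 / y := by
    have hq0 : 0 < κ / (2 * L) := by positivity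
    have h1 : 0 < √(κ / (2 * L)) := Real.sqrt_pos.2 hq0
    rw [← mul_div_assoc, div_le_div_iff₀ h1 hy0, one_mul]
    refine Real.le_sqrt_of_sq_le ?_
    rw [mul_pow, hy2, ← mul_div_assoc, div_le_div_iff₀ hDpos (by positivity)]
    rw [hD]
    nlinarith
  have hs64 : (s : ℝ) ^ 3 ≤ 64 ^ s := by
    have h1 : (s : ℝ) ≤ 2 ^ s := by exact_mod_cast (Nat.lt_two_pow_self (n := s)).le
    calc (s : ℝ) ^ 3 ≤ (2 ^ s) ^ 3 := by gcongr
      _ = 8 ^ s := by rw [← pow_mul, mul_comm, pow_mul]; norm_num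
      _ ≤ 64 ^ s := by gcongr; norm_num
  have hsq : (s : ℝ) ^ 2 ≤ 64 ^ s := (pow_le_pow_right₀ hs' (by norm_num)).trans hs64
  refine ⟨hκ, ?_, ?_⟩
  · unfold entropyBound
    rw [← hℓ]
    rcases le_or_gt 1 ℓ with h | h
    · have h1 : D * (s * ℓ) ≤ n * κ := by
        rw [← mul_div_assoc, div_le_iff₀ hn0] at hr1
        linarith
      have h2 := mul_le_mul_of_nonneg_right hD0 (show 0 ≤ s * ℓ by positivity)
      have h3 := mul_le_mul_of_nonneg_left h (show (0 : ℝ) ≤ s by positivity)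
      linarith
    -- For ℓ < 1 the entropy is of order s rather than sℓ, so the second term of the rate is not
    -- enough. The first one is, because ℓ ≥ 1/(2s) and (1/y)^s ≥ 64^s ≥ s³.
    · have h1 : (2048 * (s : ℝ)) ^ 2 ≤ (n * κ) ^ 2 := by
        refine le_trans ?_ hX'
        have h2 : (64 : ℝ) ^ s ≤ (1 / y) ^ s := by gcongr
        calc (2048 * (s : ℝ)) ^ 2 ≤ ℓ * 4096 ^ 2 * (s : ℝ) ^ 3 := by
              nlinarith [sq_nonneg (s : ℝ), mul_le_mul_of_nonneg_left hℓ2 (sq_nonneg (s : ℝ))]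
          _ ≤ ℓ * D ^ 2 * (1 / y) ^ s := by gcongr; exact hs64.trans h2
      have h3 := abs_le_of_sq_le_sq h1 (by positivity)
      have h4 := (le_abs_self _).trans h3
      have h5 := mul_lt_mul_of_pos_left h (show (0 : ℝ) < s by positivity)
      linarith
  · refine le_trans ?_ hX'
    have hE : entropyBound d s ≤ 4 * s ^ 2 * ℓ := by
      unfold entropyBound
      rw [← hℓ]
      have h1 := mul_le_mul_of_nonneg_left hℓ2 (show (0 : ℝ) ≤ s by positivity)
      have h2 := mul_le_mul_of_nonneg_right hs' (show 0 ≤ s * ℓ by positivity)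
      have h3 : 0 ≤ s * (s * ℓ) := by positivity
      linarith
    have hq0 : 0 ≤ 15 / √(κ / (2 * L)) := by positivity
    calc 1024 * ((15 / √(κ / (2 * L))) ^ s * entropyBound d s)
        ≤ 1024 * ((15 / √(κ / (2 * L))) ^ s * (4 * s ^ 2 * ℓ)) := by gcongr
      _ = ℓ * 4096 * (s ^ 2 * (15 / √(κ / (2 * L))) ^ s) := by ring
      _ ≤ ℓ * 4096 * (64 ^ s * (15 / √(κ / (2 * L))) ^ s) :=
          mul_le_mul_of_nonneg_left (mul_le_mul_of_nonneg_right hsq (pow_nonneg hq0 _))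
            (by positivity)
      _ = ℓ * 4096 * (64 * (15 / √(κ / (2 * L)))) ^ s := by rw [mul_pow]
      _ ≤ ℓ * D ^ 2 * (1 / y) ^ s :=
          mul_le_mul (mul_le_mul_of_nonneg_left (show 4096 ≤ D ^ 2 by
            calc (4096 : ℝ) ≤ 4096 ^ 2 := by norm_num
              _ ≤ D ^ 2 := by gcongr) hℓ0.le)
            (pow_le_pow_left₀ (by positivity) hyq _) (by positivity) (by positivity)

/-! ### The estimator and its error probability. -/

/-- The low frequencies used to examine the pattern `J`. -/
def lowFreq {d : ℕ} (κ L : ℝ) (J : Finset (Fin d)) : Finset (Fin d → ℤ) :=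
  freqBall J (J.card / √(κ / (2 * L)) ^ 2)

/-- The low frequencies of `J` which involve the coordinate `j`. -/
def lowFreqAt {d : ℕ} (κ L : ℝ) (J : Finset (Fin d)) (j : Fin d) : Finset (Fin d → ℤ) :=
  (lowFreq κ L J).filter fun k => k j ≠ 0

/-- The patterns whose size is such that a signal of energy `κ` is detectable. -/
def Admissible {d : ℕ} (n : ℕ) (κ L : ℝ) (J : Finset (Fin d)) : Prop :=
  1024 * entropyBound d J.card ≤ n * κ ∧
    1024 * ((lowFreq κ L J).card * entropyBound d J.card) ≤ (n * κ) ^ 2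

open Classical in
/-- The estimator: keep `j` if the empirical energy in the direction `j` of some admissible
pattern containing `j` is large. -/
def patternEstimator (n d : ℕ) (κ L : ℝ) (Y : Observation d) : Finset (Fin d) :=
  Finset.univ.filter fun j => ∃ J : Finset (Fin d), j ∈ J ∧ Admissible n κ L J ∧
    κ / 4 + (lowFreqAt κ L J j).card / n ≤ energyStat (lowFreqAt κ L J j) Y

lemma measurable_energyStat {d : ℕ} (K : Finset (Fin d → ℤ)) :
    Measurable (energyStat K : Observation d → ℝ) := by
  unfold energyStat
  exact Finset.measurable_sum _ fun k _ => (measurable_pi_apply _).pow_const 2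

lemma isEstimator_patternEstimator (n d : ℕ) (κ L : ℝ) :
    IsEstimator (patternEstimator n d κ L) := by
  intro J
  have hset : {Y | patternEstimator n d κ L Y = J}
      = ⋂ j : Fin d, {Y | j ∈ patternEstimator n d κ L Y ↔ j ∈ J} := by
    ext Y
    simp [Finset.ext_iff]
  rw [hset]
  refine MeasurableSet.iInter fun j => ?_
  have hj : MeasurableSet {Y | j ∈ patternEstimator n d κ L Y} := by
    simp only [patternEstimator, Finset.mem_filter, Finset.mem_univ, true_and]
    have : {Y : Observation d | ∃ J : Finset (Fin d), j ∈ J ∧ Admissible n κ L J ∧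
        κ / 4 + (lowFreqAt κ L J j).card / n ≤ energyStat (lowFreqAt κ L J j) Y}
        = ⋃ J : Finset (Fin d), {Y | j ∈ J ∧ Admissible n κ L J ∧
        κ / 4 + (lowFreqAt κ L J j).card / n ≤ energyStat (lowFreqAt κ L J j) Y} := by
      ext Y; simp
    rw [this]
    refine MeasurableSet.iUnion fun J => ?_
    refine (MeasurableSet.const _).inter ((MeasurableSet.const _).inter ?_)
    exact measurableSet_le measurable_const (measurable_energyStat _)
  by_cases hjJ : j ∈ J
  · simpa [hjJ] using hj
  · convert hj.compl using 1
    ext Y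
    simp [hjJ]

section Tails

variable {d n dstar : ℕ} {κ L : ℝ} {f : Cube d → ℝ} {P : Measure (Observation d)}

lemma card_lowFreqAt_le (J : Finset (Fin d)) (j : Fin d) :
    ((lowFreqAt κ L J j).card : ℝ) ≤ (lowFreq κ L J).card := by
  exact_mod_cast Finset.card_le_card (Finset.filter_subset _ _)

/-- False detections are unlikely. -/
lemma IsWhiteNoiseLaw.false_detection_le (hn : n ≠ 0) (hκ : 0 < κ)
    (h : IsWhiteNoiseLaw n f P) {J₀ J : Finset (Fin d)}
    (hf : ∃ fbar : (J₀ → unitInterval) → ℝ, ∀ x : Cube d, f x = fbar (fun j => x j))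
    (hJ : Admissible n κ L J) {j : Fin d} (hj : j ∉ J₀) :
    P.real {Y | κ / 4 + (lowFreqAt κ L J j).card / n ≤ energyStat (lowFreqAt κ L J j) Y}
      ≤ Real.exp (-6 * entropyBound d J.card) := by
  have hx : 0 < n * κ := by positivity
  have hS : 0 ≤ entropyBound d J.card :=
    (Nat.cast_nonneg _).trans (le_entropyBound (by simpa using Finset.card_le_univ J))
  have hcard := card_lowFreqAt_le (κ := κ) (L := L) J j
  obtain ⟨h1, h2⟩ := hJ
  set S := entropyBound d J.card
  set N : ℝ := ((lowFreqAt κ L J j).card : ℝ)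
  have hu : 32 * S / (n * κ) ≤ 1 / 32 := by
    rw [div_le_div_iff₀ hx (by norm_num)]; linarith
  -- This `u` balances the Chernoff exponent: the threshold κ/4 gains 8S, and the second
  -- admissibility condition caps the quadratic term by 2S.
  refine (h.energyStat_ge_le hn (fun k hk => ?_) (u := 32 * S / (n * κ)) (by positivity)
    (by linarith) _).trans (Real.exp_le_exp.2 ?_)
  · exact theta_eq_zero_of_sparse hf hj (Finset.mem_filter.1 hk).2
  · have e1 : -(32 * S / (n * κ)) * (n * (κ / 4)) = -8 * S := by field_simp; ring
    have e2 : 2 * (32 * S / (n * κ)) ^ 2 * N ≤ 2 * S := by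
      rw [div_pow, mul_div_assoc', div_mul_eq_mul_div, div_le_iff₀ (by positivity)]
      have h3 : N * S ≤ (lowFreq κ L J).card * S := mul_le_mul_of_nonneg_right hcard hS
      have h4 := mul_le_mul_of_nonneg_left (show 1024 * (N * S) ≤ (n * κ) ^ 2 by linarith) hS
      linarith
    linarith

/-- Missed detections are unlikely. -/
lemma IsWhiteNoiseLaw.missed_detection_le (hn : n ≠ 0) (hκ : 0 < κ) (hL : 0 < L)
    (h : IsWhiteNoiseLaw n f P) {J : Finset (Fin d)} (hf : ConditionC1 κ L dstar f J)
    (hJ : Admissible n κ L J) {j : Fin d} (hj : j ∈ J) :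
    P.real {Y | energyStat (lowFreqAt κ L J j) Y ≤ κ / 4 + (lowFreqAt κ L J j).card / n}
      ≤ Real.exp (-6 * entropyBound d J.card) := by
  have hn' : (0 : ℝ) < n := by positivity
  have hx : 0 < n * κ := by positivity
  have hS : 0 ≤ entropyBound d J.card :=
    (Nat.cast_nonneg _).trans (le_entropyBound (by simpa using Finset.card_le_univ J))
  have hcard := card_lowFreqAt_le (κ := κ) (L := L) J j
  have hJpos : (0 : ℝ) < J.card := by exact_mod_cast Finset.card_pos.2 ⟨j, hj⟩
  have hq : √(κ / (2 * L)) ^ 2 = κ / (2 * L) := Real.sq_sqrt (by positivity)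
  have hE : κ / 2 ≤ ∑ k ∈ lowFreqAt κ L J j, theta f k ^ 2 := by
    have := le_sum_theta_sq (m := J.card / √(κ / (2 * L)) ^ 2) hL.le (by rw [hq]; positivity) hf hj
    -- The radius of `lowFreq` is chosen so that the Sobolev tail is exactly κ/2.
    have e : J.card * L / (J.card / √(κ / (2 * L)) ^ 2) = κ / 2 := by rw [hq]; field_simp
    rw [e] at this
    unfold lowFreqAt lowFreq
    linarith
  obtain ⟨h1, h2⟩ := hJ
  refine (h.energyStat_le_le hn (lowFreqAt κ L J j)
    (u := 32 * entropyBound d J.card / (n * κ)) (by positivity) _).trans (Real.exp_le_exp.2 ?_)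
  set S := entropyBound d J.card
  set N : ℝ := ((lowFreqAt κ L J j).card : ℝ)
  set E : ℝ := ∑ k ∈ lowFreqAt κ L J j, theta f k ^ 2
  have hu : 32 * S / (n * κ) ≤ 1 / 32 := by
    rw [div_le_div_iff₀ hx (by norm_num)]; linarith
  have hu0 : 0 ≤ 32 * S / (n * κ) := by positivity
  have e1 : (32 * S / (n * κ)) * (n * κ) = 32 * S := by field_simp
  have e2 : (32 * S / (n * κ)) ^ 2 * N ≤ S := by
    rw [div_pow, div_mul_eq_mul_div, div_le_iff₀ (by positivity)]
    have h3 : N * S ≤ (lowFreq κ L J).card * S := mul_le_mul_of_nonneg_right hcard hS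
    have h4 := mul_le_mul_of_nonneg_left (show 1024 * (N * S) ≤ (n * κ) ^ 2 by linarith) hS
    linarith
  generalize 32 * S / (n * κ) = u at *
  -- The signal gains unE ≥ 16S, of which the term 2u²nE takes back at most 1/16. The threshold
  -- costs 8S and the noise S, so the exponent is at most -15S + 8S + S.
  have e3 : 32 * S ≤ 2 * (u * (n * E)) := by
    rw [← e1]
    have := mul_le_mul_of_nonneg_left (mul_le_mul_of_nonneg_left hE hn'.le) hu0
    linarith
  have e4 : u ^ 2 * (n * E) ≤ 1 / 32 * (u * (n * E)) := by
    rw [sq, mul_assoc]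
    refine mul_le_mul_of_nonneg_right hu ?_
    linarith
  have e5 : -u * (n * (E - κ / 4)) = -(u * (n * E)) + u * (n * κ) / 4 := by ring
  rw [e5, e1]
  linarith

/-- Error bound for the estimator at an admissible pattern. -/
lemma IsWhiteNoiseLaw.patternEstimator_ne_le (hn : n ≠ 0) (hκ : 0 < κ) (hL : 0 < L) (hd : 1 ≤ d)
    (h : IsWhiteNoiseLaw n f P) {J₀ : Finset (Fin d)} (hf : ConditionC1 κ L dstar f J₀)
    (hJ : Admissible n κ L J₀) :
    P {Y | patternEstimator n d κ L Y ≠ J₀} ≤ ENNReal.ofReal (4 / d) := by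
  classical
  have hP := h.gaussian.isProbabilityMeasure
  set A : Finset (Fin d) → Fin d → Set (Observation d) := fun J j =>
    {Y | κ / 4 + (lowFreqAt κ L J j).card / n ≤ energyStat (lowFreqAt κ L J j) Y} with hA
  set B : Fin d → Set (Observation d) := fun j =>
    {Y | energyStat (lowFreqAt κ L J₀ j) Y ≤ κ / 4 + (lowFreqAt κ L J₀ j).card / n} with hB
  set F : Finset (Finset (Fin d)) := Finset.univ.filter fun J => Admissible n κ L J with hF
  have hsub : {Y | patternEstimator n d κ L Y ≠ J₀}
      ⊆ (⋃ J ∈ F, ⋃ j ∈ J \ J₀, A J j) ∪ ⋃ j ∈ J₀, B j := by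
    intro Y hY
    by_contra hcon
    refine hY (Finset.ext fun j => ?_)
    simp only [Set.mem_union, Set.mem_iUnion, not_or, not_exists] at hcon
    constructor
    · intro hj
      obtain ⟨J, hjJ, hadm, hlarge⟩ := (Finset.mem_filter.1 hj).2
      by_contra hj₀
      exact hcon.1 J (Finset.mem_filter.2 ⟨Finset.mem_univ _, hadm⟩) j
        (Finset.mem_sdiff.2 ⟨hjJ, hj₀⟩) hlarge
    · intro hj
      refine Finset.mem_filter.2 ⟨Finset.mem_univ _, J₀, hj, hJ, ?_⟩
      exact (not_le.1 (hcon.2 j hj)).le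
  have hreal : P.real {Y | patternEstimator n d κ L Y ≠ J₀} ≤ 4 / d := by
    have hsum := sum_card_mul_exp_le hd
    set g : Finset (Fin d) → ℝ := fun J => (J.card : ℝ) * Real.exp (-6 * entropyBound d J.card)
      with hg
    have hg0 : ∀ J, 0 ≤ g J := fun J => by positivity
    have h1 : P.real (⋃ J ∈ F, ⋃ j ∈ J \ J₀, A J j) ≤ ∑ J, g J := by
      refine (measureReal_biUnion_finset_le _ _).trans ?_
      refine le_trans (Finset.sum_le_sum fun J hJF => ?_)
        (Finset.sum_le_sum_of_subset_of_nonneg (Finset.subset_univ F) fun J _ _ => hg0 J)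
      refine (measureReal_biUnion_finset_le _ _).trans ?_
      refine (Finset.sum_le_card_nsmul _ _ _ fun j hj => h.false_detection_le hn hκ hf.sparse
        (Finset.mem_filter.1 hJF).2 (Finset.mem_sdiff.1 hj).2).trans ?_
      rw [nsmul_eq_mul]
      refine mul_le_mul_of_nonneg_right ?_ (Real.exp_pos _).le
      exact_mod_cast Finset.card_le_card Finset.sdiff_subset
    have h2 : P.real (⋃ j ∈ J₀, B j) ≤ ∑ J, g J := by
      refine (measureReal_biUnion_finset_le _ _).trans ?_
      refine (Finset.sum_le_card_nsmul _ _ _ fun j hj =>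
        h.missed_detection_le hn hκ hL hf hJ hj).trans ?_
      rw [nsmul_eq_mul]
      exact Finset.single_le_sum (f := g) (fun J _ => hg0 J) (Finset.mem_univ J₀)
    refine (measureReal_mono hsub).trans ((measureReal_union_le _ _).trans ?_)
    have : (4 : ℝ) / d = 2 / d + 2 / d := by ring
    linarith
  rw [← ofReal_measureReal]
  exact ENNReal.ofReal_le_ofReal hreal

end Tails

/-- Above the separation rate, patterns are admissible. -/
lemma admissible_of_rate_le {L κ : ℝ} (hL : 0 < L) {n d : ℕ} (hn : 1 ≤ n)
    {J : Finset (Fin d)} (hs : 1 ≤ J.card) (hsd : J.card < d) (hκL : κ ≤ L)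
    (hrate : 4096 * (1 + 450 * L) * rate n d J.card ≤ κ) : 0 < κ ∧ Admissible n κ L J := by
  obtain ⟨hκ, h1, h2⟩ := entropyBound_le_of_rate_le hL hn hs hsd hκL hrate
  refine ⟨hκ, h1, le_trans ?_ h2⟩
  have hS : 0 ≤ entropyBound d J.card := (Nat.cast_nonneg _).trans (le_entropyBound hsd.le)
  have hq1 : √(κ / (2 * L)) ≤ 1 := by
    rw [Real.sqrt_le_one, div_le_one (by positivity)]
    linarith
  have := card_freqBall_le J (Real.sqrt_pos.2 (show 0 < κ / (2 * L) by positivity)) hq1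
  unfold lowFreq
  gcongr

lemma maxError_patternEstimator_le {L κ : ℝ} (hL : 0 < L) {n d dstar s : ℕ} (hn : 1 ≤ n)
    (hs : 1 ≤ s) (hsd : s < d) (hrate : 4096 * (1 + 450 * L) * rate n d s ≤ κ) :
    maxError n dstar s κ L (patternEstimator n d κ L) ≤ ENNReal.ofReal (4 / d) := by
  unfold maxError
  refine iSup_le fun f => iSup_le fun J => iSup_le fun P => iSup_le fun hf => iSup_le fun hJ =>
    iSup_le fun hP => ?_
  subst hJ
  -- The bound κ ≤ L costs nothing: otherwise there is no signal to consider.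
  have hκL := le_of_conditionC1 hL.le hf (Finset.card_pos.1 hs)
  obtain ⟨hκ, hadm⟩ := admissible_of_rate_le hL hn hs hsd hκL hrate
  exact hP.patternEstimator_ne_le (by omega) hκ hL (by omega) hf hadm

/-- The estimator is uniformly consistent above the separation rate. -/
lemma uniformlyConsistent_patternEstimator {L : ℝ} (hL : 0 < L) {d dstar s : ℕ → ℕ} {κ : ℕ → ℝ}
    (hd : Tendsto d atTop atTop) (hs : ∀ᶠ n in atTop, 1 ≤ s n ∧ s n < d n)
    (hrate : ∀ᶠ n in atTop, 4096 * (1 + 450 * L) * rate n (d n) (s n) ≤ κ n) :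
    UniformlyConsistent L d dstar s κ (fun n => patternEstimator n (d n) (κ n) L) := by
  have hlim : Tendsto (fun n => ENNReal.ofReal (4 / (d n : ℝ))) atTop (𝓝 0) := by
    rw [← ENNReal.ofReal_zero]
    exact ENNReal.tendsto_ofReal
      (tendsto_const_nhds.div_atTop (tendsto_natCast_atTop_atTop.comp hd))
  refine tendsto_of_tendsto_of_tendsto_of_le_of_le' tendsto_const_nhds hlim
    (Eventually.of_forall fun _ => zero_le) ?_
  filter_upwards [hs, hrate, eventually_ge_atTop 1] with n h1 h2 h3
  exact maxError_patternEstimator_le hL h3 h1.1 h1.2 h2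

/-! ### Existence of pure white noise. -/

lemma inner_Lp_two {Ω : Type*} {mΩ : MeasurableSpace Ω} {P : Measure Ω} (g h : Lp ℝ 2 P) :
    inner ℝ g h = ∫ ω, g ω * h ω ∂P := by
  rw [L2.inner_def]
  exact integral_congr_ae (ae_of_all _ fun ω => by
    simp only [RCLike.inner_apply, conj_trivial, mul_comm])

lemma integral_sq_Lp {Ω : Type*} {mΩ : MeasurableSpace Ω} {P : Measure Ω} (g : Lp ℝ 2 P) :
    ∫ ω, g ω ^ 2 ∂P = ‖g‖ ^ 2 := by
  rw [← real_inner_self_eq_norm_sq, inner_Lp_two]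
  simp_rw [sq]

section GaussianClosed

variable {Ω : Type*} {mΩ : MeasurableSpace Ω} {P : Measure Ω} [IsProbabilityMeasure P]

lemma integral_norm_le_norm_Lp (g : Lp ℝ 2 P) : ∫ ω, ‖g ω‖ ∂P ≤ ‖g‖ := by
  rw [integral_norm_eq_lintegral_enorm (Lp.aestronglyMeasurable g), Lp.norm_def,
    ← eLpNorm_one_eq_lintegral_enorm]
  exact ENNReal.toReal_mono (Lp.eLpNorm_ne_top g)
    (eLpNorm_le_eLpNorm_of_exponent_le (by norm_num) (Lp.aestronglyMeasurable g))

lemma integrable_Lp_two (g : Lp ℝ 2 P) : Integrable g P :=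
  (Lp.memLp g).integrable (by norm_num)

/-- On a probability space the L¹ norm is at most the L² norm, so a Lipschitz `F` yields a Lipschitz
functional on L². -/
lemma continuous_integral_comp_Lp {E : Type*} [NormedAddCommGroup E] [NormedSpace ℝ E]
    {F : ℝ → E} {K : ℝ} (hF : ∀ x y, ‖F x - F y‖ ≤ K * ‖x - y‖) (hK : 0 ≤ K)
    (hint : ∀ g : Lp ℝ 2 P, Integrable (fun ω => F (g ω)) P) :
    Continuous fun g : Lp ℝ 2 P => ∫ ω, F (g ω) ∂P := by
  refine (LipschitzWith.of_dist_le_mul (K := ⟨K, hK⟩) fun g h => ?_).continuous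
  rw [dist_eq_norm, dist_eq_norm, ← integral_sub (hint g) (hint h)]
  refine (norm_integral_le_of_norm_le (g := fun ω => K * ‖(g - h) ω‖)
    ((integrable_Lp_two (g - h)).norm.const_mul K) ?_).trans ?_
  · filter_upwards [Lp.coeFn_sub g h] with ω hω
    rw [hω]
    exact hF _ _
  · rw [integral_const_mul]
    exact mul_le_mul_of_nonneg_left (integral_norm_le_norm_Lp _) hK

lemma continuous_integral_Lp : Continuous fun g : Lp ℝ 2 P => ∫ ω, g ω ∂P :=
  continuous_integral_comp_Lp (F := fun x => x) (K := 1) (fun x y => by simp) zero_le_one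
    integrable_Lp_two

lemma continuous_charFun_Lp (t : ℝ) : Continuous fun g : Lp ℝ 2 P => charFun (P.map g) t := by
  have h : ∀ g : Lp ℝ 2 P, charFun (P.map g) t = ∫ ω, Complex.exp (t * g ω * Complex.I) ∂P := by
    intro g
    rw [charFun_apply_real, integral_map (Lp.aestronglyMeasurable g).aemeasurable
      (by fun_prop)]
  simp_rw [h]
  refine continuous_integral_comp_Lp (F := fun x : ℝ => Complex.exp (t * x * Complex.I))
    (K := |t|) (fun x y => ?_) (abs_nonneg t) fun g => ?_
  · have h1 : Complex.exp (t * x * Complex.I) - Complex.exp (t * y * Complex.I)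
        = Complex.exp (t * y * Complex.I) * (Complex.exp (Complex.I * ((t * (x - y) : ℝ) : ℂ)) - 1) := by
      rw [mul_sub, ← Complex.exp_add]
      push_cast
      ring_nf
    rw [h1, norm_mul, ← Complex.ofReal_mul, Complex.norm_exp_ofReal_mul_I, one_mul]
    refine (Real.norm_exp_I_mul_ofReal_sub_one_le).trans ?_
    rw [norm_mul, Real.norm_eq_abs]
  · refine Integrable.of_bound (C := 1) ?_ (ae_of_all _ fun ω => ?_)
    · exact (by fun_prop : Continuous fun x : ℝ => Complex.exp (t * x * Complex.I)).comp_aestronglyMeasurable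
        (Lp.aestronglyMeasurable g)
    · rw [← Complex.ofReal_mul, Complex.norm_exp_ofReal_mul_I]

/-- Centred Gaussian random variables form a closed subset of `L²`. -/
lemma isClosed_setOf_centered_gaussian :
    IsClosed {g : Lp ℝ 2 P | HasGaussianLaw g P ∧ ∫ ω, g ω ∂P = 0} := by
  -- For centred variables the variance is ‖g‖², so being Gaussian is a family of equations between
  -- continuous functions of `g`, one for each `t`.
  have hset : {g : Lp ℝ 2 P | HasGaussianLaw g P ∧ ∫ ω, g ω ∂P = 0}
      = {g : Lp ℝ 2 P | ∫ ω, g ω ∂P = 0} ∩ ⋂ t : ℝ,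
        {g : Lp ℝ 2 P | charFun (P.map g) t = Complex.exp (-((t ^ 2 * ‖g‖ ^ 2 / 2 : ℝ) : ℂ))} := by
    ext g
    simp only [Set.mem_ofPred_eq, Set.mem_inter_iff, Set.mem_iInter, and_comm (a := HasGaussianLaw g P)]
    refine and_congr_right fun h0 => ?_
    rw [hasGaussianLaw_iff_charFun_map_eq (Lp.aestronglyMeasurable g).aemeasurable]
    refine forall_congr' fun t => ?_
    have h1 : ∫ ω, inner ℝ t (g ω) ∂P = 0 := by
      simp only [RCLike.inner_apply, conj_trivial]
      rw [integral_mul_const, h0, zero_mul]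
    have h2 : Var[fun ω => inner ℝ t (g ω); P] = t ^ 2 * ‖g‖ ^ 2 := by
      rw [variance_of_integral_eq_zero
        ((Lp.aestronglyMeasurable g).aemeasurable.const_inner) h1]
      simp only [RCLike.inner_apply, conj_trivial, mul_pow]
      rw [integral_mul_const, integral_sq_Lp, mul_comm]
    rw [h1, h2]
    push_cast
    rw [zero_mul, zero_sub]
  rw [hset]
  refine (isClosed_eq continuous_integral_Lp continuous_const).inter
    (isClosed_iInter fun t => isClosed_eq (continuous_charFun_Lp t) ?_)
  fun_prop

end GaussianClosed

/-- The isonormal process over a Hilbert space: an isometric embedding into a space of centred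
Gaussian random variables. -/
lemma exists_isonormal (H : Type) [NormedAddCommGroup H] [InnerProductSpace ℝ H]
    [CompleteSpace H] :
    ∃ (Ω : Type) (_ : MeasurableSpace Ω) (P : Measure Ω) (_ : IsProbabilityMeasure P)
      (U : H →ₗᵢ[ℝ] Lp ℝ 2 P), ∀ φ, HasGaussianLaw (U φ) P ∧ ∫ ω, U φ ω ∂P = 0 := by
  obtain ⟨w, b, -⟩ := exists_hilbertBasis ℝ H
  obtain ⟨Ω, mΩ, P, X, hXm, hXl, hXi, hP⟩ := exists_iid w (gaussianReal 0 1)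
  have hmem : ∀ i, MemLp (X i) 2 P := fun i => (hXl i).hasGaussianLaw.memLp_two
  have hmean : ∀ i, ∫ ω, X i ω ∂P = 0 := fun i => by
    rw [(hXl i).integral_eq, integral_id_gaussianReal]
  have hvar : ∀ i, Var[X i; P] = 1 := fun i => by
    rw [(hXl i).variance_eq, variance_id_gaussianReal]; rfl
  set ξ : w → Lp ℝ 2 P := fun i => (hmem i).toLp (X i) with hξ
  have hξX : ∀ i, ξ i =ᵐ[P] X i := fun i => (hmem i).coeFn_toLp
  have horth : Orthonormal ℝ ξ := by
    classical
    rw [orthonormal_iff_ite]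
    intro i j
    have h1 : inner ℝ (ξ i) (ξ j) = ∫ ω, X i ω * X j ω ∂P := by
      rw [inner_Lp_two]
      refine integral_congr_ae ?_
      filter_upwards [hξX i, hξX j] with ω h1 h2
      rw [h1, h2]
    rw [h1]
    split_ifs with hij
    · subst hij
      rw [← hvar i, variance_of_integral_eq_zero (hXm i).aemeasurable (hmean i)]
      simp_rw [sq]
    · rw [(hXi.indepFun hij).integral_fun_mul_eq_mul_integral (hXm i).aestronglyMeasurable
        (hXm j).aestronglyMeasurable, hmean, zero_mul]
  -- A Hilbert basis is sent to i.i.d. standard Gaussians. Finite combinations are Gaussian by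
  -- independence, and general elements are L² limits of them.
  refine ⟨Ω, mΩ, P, hP, horth.orthogonalFamily.linearIsometry.comp b.repr.toLinearIsometry,
    fun φ => ?_⟩
  have key : ∀ (c : w → ℝ) (s : Finset w),
      (∑ i ∈ s, c i • ξ i : Lp ℝ 2 P) ∈ {g : Lp ℝ 2 P | HasGaussianLaw g P ∧ ∫ ω, g ω ∂P = 0} := by
    intro c s
    have hae : (fun ω => ∑ i : s, c i * X i ω) =ᵐ[P] (∑ i ∈ s, c i • ξ i : Lp ℝ 2 P) := by
      have h1 : ∀ᵐ ω ∂P, ∀ i ∈ s, (c i • ξ i : Lp ℝ 2 P) ω = c i * X i ω := by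
        rw [Filter.eventually_all_finset]
        intro i _
        filter_upwards [Lp.coeFn_smul (c i) (ξ i), hξX i] with ω h1 h2
        rw [h1, Pi.smul_apply, h2, smul_eq_mul]
      filter_upwards [h1, Lp.coeFn_finsetSum s (fun i => c i • ξ i)] with ω h1 h2
      rw [h2, Finset.sum_apply, Finset.sum_coe_sort s (fun i => c i * X i ω)]
      exact Finset.sum_congr rfl fun i hi => (h1 i hi).symm
    have hgauss : HasGaussianLaw (fun ω => ∑ i : s, c i * X i ω) P := by
      refine iIndepFun.hasGaussianLaw_fun_sum (X := fun (i : s) ω => c i * X i ω)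
        (fun i => ((hXl i).hasGaussianLaw.fun_smul (c i))) ?_
      exact (hXi.precomp (g := fun i : s => (i : w)) Subtype.val_injective).comp
        (fun i x => c i * x) fun i => by fun_prop
    refine ⟨hgauss.congr hae, ?_⟩
    rw [← integral_congr_ae hae, integral_finsetSum _ fun (i : s) _ =>
      ((hmem (i : w)).integrable (by norm_num)).const_mul (c i)]
    simp_rw [integral_const_mul, hmean, mul_zero, Finset.sum_const_zero]
  have hsum := horth.orthogonalFamily.hasSum_linearIsometry (b.repr φ)
  exact isClosed_setOf_centered_gaussian.mem_of_tendsto hsum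
    (Eventually.of_forall fun s => key (fun i => b.repr φ i) s)

/-- A linear functional of finitely many coordinates is almost surely `U` of a linear combination of
the indices, hence Gaussian by assumption. -/
lemma isGaussianProcess_of_linear {Ω T : Type*} {mΩ : MeasurableSpace Ω} {P : Measure Ω}
    [IsProbabilityMeasure P] [NormedAddCommGroup T] [InnerProductSpace ℝ T]
    (U : T →ₗᵢ[ℝ] Lp ℝ 2 P) (hU : ∀ φ, HasGaussianLaw (U φ) P) :
    IsGaussianProcess (fun φ ω => U φ ω) P := by
  refine ⟨fun I => ⟨isGaussian_of_isGaussian_map fun L => ?_⟩⟩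
  have hm : Measurable fun ω => I.restrict fun φ => U φ ω :=
    measurable_pi_lambda _ fun i => (Lp.stronglyMeasurable (U i)).measurable
  rw [Measure.map_map L.continuous.measurable hm]
  classical
  have hae : (U (∑ i : I, L (Pi.single i 1) • (i : T)) : Ω → ℝ)
      =ᵐ[P] L ∘ fun ω => I.restrict fun φ => U φ ω := by
    rw [map_sum]
    have h1 : ∀ i : I, U (L (Pi.single i 1) • (i : T)) = L (Pi.single i 1) • U (i : T) :=
      fun i => map_smul U _ _
    simp_rw [h1]
    have h2 : ∀ᵐ ω ∂P, ∀ i : I, (L (Pi.single i 1) • U (i : T) : Lp ℝ 2 P) ω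
        = L (Pi.single i 1) * U (i : T) ω := by
      rw [ae_all_iff]
      intro i
      filter_upwards [Lp.coeFn_smul (L (Pi.single i 1)) (U (i : T))] with ω h1
      rw [h1, Pi.smul_apply, smul_eq_mul]
    filter_upwards [h2, Lp.coeFn_finsetSum Finset.univ
      (fun i : I => L (Pi.single i 1) • U (i : T))] with ω h2 h3
    rw [h3, Finset.sum_apply, Function.comp_apply,
      pi_eq_sum_univ' (I.restrict fun φ => U φ ω), map_sum]
    refine Finset.sum_congr rfl fun i _ => ?_
    rw [h2 i, map_smul, smul_eq_mul, mul_comm]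
    congr 3
  rw [← Measure.map_congr hae]
  exact (hU _).isGaussian_map

/-- White noise without signal. -/
lemma exists_isWhiteNoiseLaw_zero (d n : ℕ) :
    ∃ P : Measure (Observation d), IsWhiteNoiseLaw n (fun _ => 0) P := by
  obtain ⟨Ω, mΩ, P, hP, U, hU⟩ := exists_isonormal (TestSpace d)
  set c : ℝ := √(1 / n) with hc
  have hc2 : c * c = 1 / n := Real.mul_self_sqrt (by positivity)
  have hgauss : IsGaussianProcess (fun (φ : TestSpace d) ω => U (c • φ) ω) P :=
    (isGaussianProcess_of_linear U fun φ => (hU φ).1).comp_right (fun φ => c • φ)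
  have hXm : ∀ φ : TestSpace d, Measurable (U (c • φ)) :=
    fun φ => (Lp.stronglyMeasurable _).measurable
  have hcov : ∀ φ ψ : TestSpace d, cov[fun ω => U (c • φ) ω, fun ω => U (c • ψ) ω; P]
      = (1 / (n : ℝ)) * ∫ x, φ x * ψ x := by
    intro φ ψ
    rw [covariance_eq_sub ((hgauss.hasGaussianLaw_eval φ).memLp_two)
      ((hgauss.hasGaussianLaw_eval ψ).memLp_two), (hU _).2, zero_mul, sub_zero]
    have h1 := inner_Lp_two (U (c • φ)) (U (c • ψ))
    rw [U.inner_map_map, real_inner_smul_left, real_inner_smul_right, inner_Lp_two φ ψ,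
      ← mul_assoc, hc2] at h1
    exact h1.symm
  have hΦ : Measurable fun ω (φ : TestSpace d) => U (c • φ) ω := measurable_pi_lambda _ hXm
  refine ⟨P.map fun ω φ => U (c • φ) ω, ⟨⟨fun I => ⟨?_⟩⟩, fun φ => ?_, fun φ ψ => ?_⟩⟩
  · have hI : Measurable fun Y : Observation d => I.restrict fun φ => Y φ :=
      measurable_pi_lambda _ fun i => measurable_pi_apply (i : TestSpace d)
    rw [Measure.map_map hI hΦ]
    exact (hgauss.hasGaussianLaw I).isGaussian_map
  · rw [integral_map hΦ.aemeasurable (measurable_pi_apply φ).aestronglyMeasurable, (hU _).2]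
    simp
  · rw [covariance_map (measurable_pi_apply φ).aestronglyMeasurable
      (measurable_pi_apply ψ).aestronglyMeasurable hΦ.aemeasurable]
    exact hcov φ ψ

/-! ### Exponential tilting of Gaussian laws. -/

lemma eq_gaussianReal_of_mgf {μ : Measure ℝ} [IsProbabilityMeasure μ] {m : ℝ} {v : NNReal}
    (h : ∀ t, mgf id μ t = Real.exp (m * t + v * t ^ 2 / 2)) : μ = gaussianReal m v := by
  have h1 : mgf id μ = mgf id (gaussianReal m v) := by
    ext t
    rw [h, mgf_id_gaussianReal]
  have h2 := eqOn_complexMGF_of_mgf h1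
  rw [integrableExpSet_eq_of_mgf h1, integrableExpSet_id_gaussianReal] at h2
  refine Measure.ext_of_complexMGF_id_eq (funext fun z => h2 ?_)
  simp

section Tilt

variable {Ω : Type*} {mΩ : MeasurableSpace Ω} {P : Measure Ω} {Z W : Ω → ℝ}

lemma integrable_exp_of_hasGaussianLaw (hZ : HasGaussianLaw Z P) :
    Integrable (fun ω => Real.exp (Z ω)) P := by
  have h := integrable_exp_mul_gaussianReal (μ := P[Z]) (v := Var[Z; P].toNNReal) 1
  rw [← hZ.map_eq_gaussianReal] at h
  simpa [Function.comp_def] using h.comp_aemeasurable hZ.aemeasurable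

lemma integral_exp_of_hasGaussianLaw (hZ : HasGaussianLaw Z P) :
    ∫ ω, Real.exp (Z ω) ∂P = Real.exp (P[Z] + Var[Z; P] / 2) := by
  have h := mgf_gaussianReal hZ.map_eq_gaussianReal 1
  rw [Real.coe_toNNReal _ (variance_nonneg _ _)] at h
  simpa [mgf] using h

lemma isProbabilityMeasure_tilted_of_hasGaussianLaw (hZ : HasGaussianLaw Z P) :
    IsProbabilityMeasure (P.tilted Z) := by
  have := hZ.isProbabilityMeasure
  exact isProbabilityMeasure_tilted (integrable_exp_of_hasGaussianLaw hZ)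

/-- Exponential tilting of a Gaussian pair shifts the mean by the covariance. -/
lemma map_tilted_of_hasGaussianLaw (h : HasGaussianLaw (fun ω => (Z ω, W ω)) P) :
    (P.tilted Z).map W = gaussianReal (P[W] + cov[Z, W; P]) Var[W; P].toNNReal := by
  have hP := h.isProbabilityMeasure
  have hQ := isProbabilityMeasure_tilted_of_hasGaussianLaw h.fst
  have hWm : AEMeasurable W (P.tilted Z) :=
    h.snd.aemeasurable.mono_ac (tilted_absolutelyContinuous P Z)
  have := Measure.isProbabilityMeasure_map hWm
  refine eq_gaussianReal_of_mgf fun t => ?_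
  rw [mgf_id_map hWm]
  have hZW : HasGaussianLaw (Z + fun ω => t * W ω) P :=
    h.map (ContinuousLinearMap.fst ℝ ℝ ℝ + t • ContinuousLinearMap.snd ℝ ℝ ℝ)
  have hmean : P[Z + fun ω => t * W ω] = P[Z] + t * P[W] := by
    simp_rw [Pi.add_apply]
    rw [integral_add h.fst.integrable (h.snd.integrable.const_mul t), integral_const_mul]
  have hvar : Var[Z + fun ω => t * W ω; P] = Var[Z; P] + 2 * (t * cov[Z, W; P])
      + t ^ 2 * Var[W; P] := by
    rw [variance_add h.fst.memLp_two (h.snd.memLp_two.const_mul t),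
      covariance_const_mul_right, variance_const_mul]
  unfold mgf
  rw [integral_exp_tilted, integral_exp_of_hasGaussianLaw hZW,
    integral_exp_of_hasGaussianLaw h.fst, ← Real.exp_sub, hmean, hvar,
    Real.coe_toNNReal _ (variance_nonneg _ _)]
  congr 1
  ring

lemma hasGaussianLaw_tilted (h : HasGaussianLaw (fun ω => (Z ω, W ω)) P) :
    HasGaussianLaw W (P.tilted Z) :=
  ⟨by rw [map_tilted_of_hasGaussianLaw h]; infer_instance⟩

lemma integral_tilted_of_hasGaussianLaw (h : HasGaussianLaw (fun ω => (Z ω, W ω)) P) :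
    (P.tilted Z)[W] = P[W] + cov[Z, W; P] := by
  rw [← integral_id_gaussianReal (μ := P[W] + cov[Z, W; P]) (v := Var[W; P].toNNReal),
    ← map_tilted_of_hasGaussianLaw h,
    integral_map (hasGaussianLaw_tilted h).aemeasurable (by fun_prop)]

lemma variance_tilted_of_hasGaussianLaw (h : HasGaussianLaw (fun ω => (Z ω, W ω)) P) :
    Var[W; P.tilted Z] = Var[W; P] := by
  have h1 := variance_fun_id_gaussianReal (μ := P[W] + cov[Z, W; P]) (v := Var[W; P].toNNReal)
  rw [← map_tilted_of_hasGaussianLaw h,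
    variance_map (by fun_prop) (hasGaussianLaw_tilted h).aemeasurable,
    Real.coe_toNNReal _ (variance_nonneg _ _)] at h1
  exact h1

variable {T : Type*} {X : T → Ω → ℝ}

/-- Any linear functional of a marginal is jointly Gaussian with `X t₀`, so the statement reduces to
tilting a Gaussian pair. -/
lemma isGaussianProcess_tilted (hX : IsGaussianProcess X P) (t₀ : T) :
    IsGaussianProcess X (P.tilted (X t₀)) := by
  refine ⟨fun I => ⟨isGaussian_of_isGaussian_map fun L => ?_⟩⟩
  have hm : AEMeasurable (fun ω => I.restrict (X · ω)) (P.tilted (X t₀)) :=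
    (hX.hasGaussianLaw I).aemeasurable.mono_ac (tilted_absolutelyContinuous P _)
  rw [AEMeasurable.map_map_of_aemeasurable L.continuous.measurable.aemeasurable hm]
  have hY : IsGaussianProcess
      (fun (b : Bool) ω => if b then X t₀ ω else L (I.restrict (X · ω))) P := by
    refine hX.of_isGaussianProcess fun b => ?_
    cases b
    · exact ⟨I, L, fun ω => by simp⟩
    · exact ⟨{t₀}, ContinuousLinearMap.proj ⟨t₀, by simp⟩, fun ω => by simp [Finset.restrict]⟩
  have hpair := hY.hasGaussianLaw_prodMk (s := true) (t := false)
  simp only [if_true, Bool.false_eq_true, if_false] at hpair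
  exact (hasGaussianLaw_tilted hpair).isGaussian_map

/-- Polarization: tilting preserves the variances of `X s`, `X t` and `X s + X t`. -/
lemma covariance_tilted (hX : IsGaussianProcess X P) (t₀ s t : T) :
    cov[X s, X t; P.tilted (X t₀)] = cov[X s, X t; P] := by
  have hP := hX.isProbabilityMeasure
  have hQ := isProbabilityMeasure_tilted_of_hasGaussianLaw (hX.hasGaussianLaw_eval t₀)
  have hX' := isGaussianProcess_tilted hX t₀
  have hs := variance_tilted_of_hasGaussianLaw (hX.hasGaussianLaw_prodMk (s := t₀) (t := s))
  have ht := variance_tilted_of_hasGaussianLaw (hX.hasGaussianLaw_prodMk (s := t₀) (t := t))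
  have hY : IsGaussianProcess
      (fun (b : Bool) ω => if b then X t₀ ω else (X s + X t) ω) P := by
    classical
    refine hX.of_isGaussianProcess fun b => ?_
    cases b
    · exact ⟨{s, t}, ContinuousLinearMap.proj ⟨s, by simp⟩ + ContinuousLinearMap.proj ⟨t, by simp⟩,
        fun ω => by simp [Finset.restrict]⟩
    · exact ⟨{t₀}, ContinuousLinearMap.proj ⟨t₀, by simp⟩, fun ω => by simp [Finset.restrict]⟩
  have hpair := hY.hasGaussianLaw_prodMk (s := true) (t := false)
  simp only [if_true, Bool.false_eq_true, if_false] at hpair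
  have hst := variance_tilted_of_hasGaussianLaw hpair
  have e1 := variance_add (hX.hasGaussianLaw_eval s).memLp_two (hX.hasGaussianLaw_eval t).memLp_two
  have e2 := variance_add (hX'.hasGaussianLaw_eval s).memLp_two
    (hX'.hasGaussianLaw_eval t).memLp_two
  have e3 : Var[X s + X t; P.tilted (X t₀)] = Var[X s + X t; P] := hst
  rw [e1, e2, hs, ht] at e3
  linarith

end Tilt

/-- Tilting the pure noise law by `n ⟨f, Y⟩` gives the white noise law with signal `f`. -/
lemma IsWhiteNoiseLaw.tilted {d n : ℕ} (hn : n ≠ 0) {P : Measure (Observation d)}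
    (h : IsWhiteNoiseLaw n (fun _ => 0) P) {f : Cube d → ℝ} (φ₀ : TestSpace d)
    (hf : φ₀ =ᵐ[volume] fun x => n * f x) :
    IsWhiteNoiseLaw n f (P.tilted fun Y => Y φ₀) := by
  have hn' : (n : ℝ) ≠ 0 := by exact_mod_cast hn
  refine ⟨isGaussianProcess_tilted h.gaussian φ₀, fun φ => ?_, fun φ ψ => ?_⟩
  · rw [integral_tilted_of_hasGaussianLaw
      (h.gaussian.hasGaussianLaw_prodMk (s := φ₀) (t := φ)), h.mean, h.cov]
    simp only [zero_mul, integral_zero, zero_add]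
    rw [← integral_const_mul]
    refine integral_congr_ae ?_
    filter_upwards [hf] with x hx
    rw [hx]
    field_simp
  · rw [covariance_tilted h.gaussian φ₀ φ ψ, h.cov]

/-- The likelihood ratio of the tilted law. -/
lemma IsWhiteNoiseLaw.integral_exp {d n : ℕ} {P : Measure (Observation d)}
    (h : IsWhiteNoiseLaw n (fun _ => 0) P) (φ : TestSpace d) :
    Integrable (fun Y => Real.exp (Y φ)) P ∧
    ∫ Y, Real.exp (Y φ) ∂P = Real.exp ((∫ x, φ x * φ x) / (2 * n)) := by
  have hg := h.gaussian.hasGaussianLaw_eval φ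
  refine ⟨integrable_exp_of_hasGaussianLaw hg, ?_⟩
  rw [integral_exp_of_hasGaussianLaw hg, h.mean, ← covariance_self (measurable_pi_apply _).aemeasurable,
    h.cov]
  simp only [zero_mul, integral_zero, zero_add]
  congr 1
  ring

/-- Mixed second moments of likelihood ratios. -/
lemma IsWhiteNoiseLaw.integral_exp_add {d n : ℕ} {P : Measure (Observation d)}
    (h : IsWhiteNoiseLaw n (fun _ => 0) P) (φ ψ : TestSpace d) :
    Integrable (fun Y => Real.exp (Y φ + Y ψ)) P ∧
    ∫ Y, Real.exp (Y φ + Y ψ) ∂P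
      = Real.exp ((∫ x, φ x * φ x) / (2 * n) + (∫ x, ψ x * ψ x) / (2 * n)
        + (∫ x, φ x * ψ x) / n) := by
  have hP := h.gaussian.isProbabilityMeasure
  have hg : HasGaussianLaw ((fun Y : Observation d => Y φ) + fun Y => Y ψ) P :=
    h.gaussian.hasGaussianLaw_add
  have hφ := h.gaussian.hasGaussianLaw_eval φ
  have hψ := h.gaussian.hasGaussianLaw_eval ψ
  refine ⟨integrable_exp_of_hasGaussianLaw hg, (integral_exp_of_hasGaussianLaw hg).trans ?_⟩
  have hm : (∫ Y, ((fun Y : Observation d => Y φ) + fun Y : Observation d => Y ψ) Y ∂P : ℝ) = 0 := by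
    simp only [Pi.add_apply]
    rw [integral_add hφ.integrable hψ.integrable, h.mean, h.mean]
    simp
  rw [hm, variance_add hφ.memLp_two hψ.memLp_two, ← covariance_self (measurable_pi_apply _).aemeasurable,
    ← covariance_self (measurable_pi_apply _).aemeasurable, h.cov, h.cov, h.cov]
  congr 1
  ring

/-! ### Hard signals: trigonometric polynomials on boxes. -/

section TrigPoly

variable {d : ℕ}

/-- The trigonometric polynomial with coefficients `c` over `K`. -/
def trigPoly (K : Finset (Fin d → ℤ)) (c : (Fin d → ℤ) → ℝ) (x : Cube d) : ℝ :=
  ∑ k ∈ K, c k * trig k x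

/-- The trigonometric polynomial with coefficients `c` over `K` as an element of `L²`. -/
def trigPolyLp (K : Finset (Fin d → ℤ)) (c : (Fin d → ℤ) → ℝ) : TestSpace d :=
  ∑ k ∈ K, c k • trigLp k

lemma orthonormal_trigLp : Orthonormal ℝ (trigLp : (Fin d → ℤ) → TestSpace d) := by
  classical
  rw [orthonormal_iff_ite]
  intro k l
  rw [inner_Lp_two, integral_trigLp_mul_trigLp]

lemma integral_trigPolyLp_mul (K : Finset (Fin d → ℤ)) (c c' : (Fin d → ℤ) → ℝ) :
    ∫ x, trigPolyLp K c x * trigPolyLp K c' x = ∑ k ∈ K, c k * c' k := by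
  rw [← inner_Lp_two]
  unfold trigPolyLp
  simpa using orthonormal_trigLp.inner_sum c c' K

lemma coeFn_trigPolyLp (K : Finset (Fin d → ℤ)) (c : (Fin d → ℤ) → ℝ) :
    trigPolyLp K c =ᵐ[volume] trigPoly K c := by
  have h1 : ∀ᵐ x : Cube d, ∀ k ∈ K, (c k • trigLp k : TestSpace d) x = c k * trig k x := by
    rw [Filter.eventually_all_finset]
    intro k _
    filter_upwards [Lp.coeFn_smul (c k) (trigLp k), coeFn_trigLp k] with x h1 h2
    rw [h1, Pi.smul_apply, h2, smul_eq_mul]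
  filter_upwards [h1, Lp.coeFn_finsetSum K (fun k => c k • trigLp k)] with x h1 h2
  unfold trigPolyLp trigPoly
  rw [h2, Finset.sum_apply]
  exact Finset.sum_congr rfl fun k hk => h1 k hk

lemma continuous_trigPoly (K : Finset (Fin d → ℤ)) (c : (Fin d → ℤ) → ℝ) :
    Continuous (trigPoly K c) := by
  unfold trigPoly
  exact continuous_finsetSum _ fun k _ => (continuous_trig k).const_mul _

open Classical in
lemma theta_trigPoly (K : Finset (Fin d → ℤ)) (c : (Fin d → ℤ) → ℝ) (l : Fin d → ℤ) :
    theta (trigPoly K c) l = if l ∈ K then c l else 0 := by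
  unfold theta trigPoly
  simp_rw [Finset.sum_mul, mul_assoc]
  rw [integral_finsetSum]
  · simp_rw [integral_const_mul, integral_trig_mul_trig, mul_ite, mul_one, mul_zero]
    rw [Finset.sum_ite_eq']
  · intro k _
    exact (Continuous.integrable_of_hasCompactSupport
      ((continuous_trig k).mul (continuous_trig l)) (HasCompactSupport.of_compactSpace _)).const_mul _

/-- The positive frequencies bounded by `p`, supported exactly in `J`. -/
def boxFreq (J : Finset (Fin d)) (p : ℕ) : Finset (Fin d → ℤ) :=
  Fintype.piFinset fun i => if i ∈ J then Finset.Icc 1 (p : ℤ) else {0}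

lemma card_boxFreq (J : Finset (Fin d)) (p : ℕ) : (boxFreq J p).card = p ^ J.card := by
  unfold boxFreq
  rw [Fintype.card_piFinset]
  have : ∀ i, (if i ∈ J then Finset.Icc 1 (p : ℤ) else {0}).card = if i ∈ J then p else 1 := by
    intro i
    split_ifs <;> simp
  simp_rw [this]
  rw [Finset.prod_ite_mem, Finset.univ_inter, Finset.prod_const]

lemma mem_boxFreq {J : Finset (Fin d)} {p : ℕ} {k : Fin d → ℤ} (hk : k ∈ boxFreq J p) (i : Fin d) :
    (i ∈ J → 1 ≤ k i ∧ k i ≤ p) ∧ (i ∉ J → k i = 0) := by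
  have := Fintype.mem_piFinset.1 hk i
  constructor
  · intro hi
    rw [if_pos hi, Finset.mem_Icc] at this
    exact this
  · intro hi
    rw [if_neg hi, Finset.mem_singleton] at this
    exact this

/-- Every frequency of the box has all its `J`-coordinates in {1,…,p}. So each `Q_j` with `j ∈ J` is
the whole energy, and each Sobolev sum is at most p² times it, whatever the signs. -/
lemma conditionC1_trigPoly {J : Finset (Fin d)} {p dstar : ℕ} {κ L a : ℝ} (hJ : J.card ≤ dstar)
    {c : (Fin d → ℤ) → ℝ} (hc : ∀ k, c k ^ 2 = a)
    (hκ : κ ≤ p ^ J.card * a) (hL : p ^ 2 * (p ^ J.card * a) ≤ L) :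
    ConditionC1 κ L dstar (trigPoly (boxFreq J p) c) J := by
  classical
  have ha : 0 ≤ a := hc 0 ▸ sq_nonneg _
  refine ⟨⟨?_, fun j => ?_⟩, hJ, ?_, fun j hj => ?_⟩
  · exact (continuous_trigPoly _ _).memLp_of_hasCompactSupport (HasCompactSupport.of_compactSpace _)
  · rw [tsum_eq_sum (s := boxFreq J p) fun k hk => by rw [theta_trigPoly, if_neg hk]; simp,
      ← ENNReal.ofReal_sum_of_nonneg fun k _ => by positivity]
    refine ENNReal.ofReal_le_ofReal (le_trans ?_ hL)
    have hterm : ∀ k ∈ boxFreq J p, (k j : ℝ) ^ 2 * theta (trigPoly (boxFreq J p) c) k ^ 2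
        ≤ p ^ 2 * a := by
      intro k hk
      rw [theta_trigPoly, if_pos hk, hc]
      refine mul_le_mul_of_nonneg_right ?_ ha
      by_cases hj : j ∈ J
      · obtain ⟨h1, h2⟩ := (mem_boxFreq hk j).1 hj
        have h1' : (1 : ℝ) ≤ k j := by exact_mod_cast h1
        have h2' : (k j : ℝ) ≤ p := by exact_mod_cast h2
        gcongr
      · rw [(mem_boxFreq hk j).2 hj]
        simp
    refine (Finset.sum_le_card_nsmul _ _ _ hterm).trans (le_of_eq ?_)
    rw [card_boxFreq, nsmul_eq_mul]
    push_cast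
    ring
  · refine ⟨fun y => trigPoly (boxFreq J p) c fun i => if h : i ∈ J then y ⟨i, h⟩ else 0,
      fun x => ?_⟩
    unfold trigPoly
    refine Finset.sum_congr rfl fun k hk => ?_
    have hdot : dot k x = dot k fun i => if h : i ∈ J then x i else 0 := by
      unfold dot
      refine Finset.sum_congr rfl fun i _ => ?_
      by_cases hi : i ∈ J
      · simp [hi]
      · rw [(mem_boxFreq hk i).2 hi]
        simp
    unfold trig
    rw [hdot]
  · unfold Q
    refine le_trans ?_ (ENNReal.sum_le_tsum
      ((boxFreq J p).subtype fun k : Fin d → ℤ => k j ≠ 0))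
    rw [← ENNReal.ofReal_sum_of_nonneg fun k _ => by positivity]
    refine ENNReal.ofReal_le_ofReal (hκ.trans (le_of_eq ?_))
    have hne : ∀ k ∈ boxFreq J p, k j ≠ 0 := fun k hk => by
      have := ((mem_boxFreq hk j).1 hj).1
      omega
    rw [Finset.sum_subtype_of_mem (fun k => theta (trigPoly (boxFreq J p) c) k ^ 2) hne,
      Finset.sum_congr rfl fun k hk => by rw [theta_trigPoly, if_pos hk, hc], Finset.sum_const,
      card_boxFreq, nsmul_eq_mul]
    push_cast
    ring

end TrigPoly

/-! ### Multiple testing and second moments of mixtures. -/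

/-- Testing many hypotheses whose likelihood ratios have bounded second moments. -/
lemma sum_setIntegral_le_sqrt {Ω ι : Type*} {mΩ : MeasurableSpace Ω} {P : Measure Ω}
    [IsProbabilityMeasure P] (𝒥 : Finset ι) {A : ι → Set Ω} (hA : ∀ i, MeasurableSet (A i))
    (hdisj : Pairwise (Function.onFun Disjoint A)) {g : ι → Ω → ℝ}
    (hg : ∀ i ∈ 𝒥, Integrable (g i) P) (hg2 : ∀ i ∈ 𝒥, Integrable (fun ω => g i ω ^ 2) P)
    {B : ℝ} (hB : 0 < B) (hgB : ∀ i ∈ 𝒥, ∫ ω, g i ω ^ 2 ∂P ≤ B) :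
    ∑ i ∈ 𝒥, ∫ ω in A i, g i ω ∂P ≤ √(𝒥.card * B) := by
  rcases 𝒥.eq_empty_or_nonempty with rfl | hne
  · simp
  have hM : (0 : ℝ) < 𝒥.card := by exact_mod_cast hne.card_pos
  set r := √(𝒥.card * B) with hr
  have hr0 : 0 < r := Real.sqrt_pos.2 (by positivity)
  have hr2 : r * r = 𝒥.card * B := Real.mul_self_sqrt (by positivity)
  have hterm : ∀ i ∈ 𝒥, ∫ ω in A i, g i ω ∂P ≤ r / 2 * P.real (A i) + B / (2 * r) := by
    intro i hi
    -- AM–GM with the optimal `r`: after summation, disjointness bounds the first part by r/2, and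
    -- the second is |𝒥|B/(2r) = r/2.
    have hpt : ∀ ω, g i ω ≤ r / 2 + 1 / (2 * r) * g i ω ^ 2 := by
      intro ω
      rw [← sub_nonneg]
      have : r / 2 + 1 / (2 * r) * g i ω ^ 2 - g i ω = (r - g i ω) ^ 2 / (2 * r) := by
        field_simp
        ring
      rw [this]
      positivity
    calc ∫ ω in A i, g i ω ∂P ≤ ∫ ω in A i, (r / 2 + 1 / (2 * r) * g i ω ^ 2) ∂P :=
          integral_mono (hg i hi).integrableOn
            ((integrable_const _).add ((hg2 i hi).integrableOn.const_mul _)) hpt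
      _ = r / 2 * P.real (A i) + 1 / (2 * r) * ∫ ω in A i, g i ω ^ 2 ∂P := by
          rw [integral_add (integrable_const _) ((hg2 i hi).integrableOn.const_mul _),
            integral_const_mul, setIntegral_const, smul_eq_mul, mul_comm (P.real _)]
      _ ≤ r / 2 * P.real (A i) + 1 / (2 * r) * B := by
          gcongr
          exact (setIntegral_le_integral (hg2 i hi) (ae_of_all _ fun ω => sq_nonneg _)).trans
            (hgB i hi)
      _ = _ := by ring
  refine (Finset.sum_le_sum hterm).trans ?_
  rw [Finset.sum_add_distrib, ← Finset.mul_sum, Finset.sum_const, nsmul_eq_mul]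
  have h1 : ∑ i ∈ 𝒥, P.real (A i) ≤ 1 := by
    rw [← measureReal_biUnion_finset (fun i _ j _ hij => hdisj hij) fun i _ => hA i]
    exact measureReal_le_one
  have h2 : (𝒥.card : ℝ) * (B / (2 * r)) = r / 2 := by
    rw [← mul_div_assoc, ← hr2]
    field_simp
  rw [h2]
  nlinarith

/-- The sign pattern associated with a set of frequencies. -/
def signOf {α : Type*} [DecidableEq α] (A : Finset α) (k : α) : ℝ := if k ∈ A then 1 else -1

lemma signOf_mul_self {α : Type*} [DecidableEq α] (A : Finset α) (k : α) :
    signOf A k * signOf A k = 1 := by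
  unfold signOf
  split_ifs <;> norm_num

/-- Exponential moments of a Rademacher sum. -/
lemma sum_powerset_exp_signOf {α : Type*} [DecidableEq α] (K A' : Finset α) (u : ℝ) :
    ∑ A ∈ K.powerset, Real.exp (u * ∑ k ∈ K, signOf A k * signOf A' k)
      = (2 * Real.cosh u) ^ K.card := by
  -- As cosh is even, the signs of `A'` do not matter; expanding the product of binary sums gives
  -- the sum over subsets.
  have h1 : ∀ k : α, 2 * Real.cosh u = Real.exp (u * signOf A' k) + Real.exp (-(u * signOf A' k)) := by
    intro k
    rw [Real.cosh_eq]
    unfold signOf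
    split_ifs
    · rw [mul_one]; ring
    · rw [mul_neg_one, neg_neg]; ring
  rw [← Finset.prod_const, Finset.prod_congr rfl fun k _ => h1 k, Finset.prod_add]
  refine Finset.sum_congr rfl fun A hA => ?_
  rw [Finset.mem_powerset] at hA
  rw [← Real.exp_sum, ← Real.exp_sum, ← Real.exp_add, Finset.mul_sum, ← Finset.sum_sdiff hA,
    add_comm]
  congr 2
  · refine Finset.sum_congr rfl fun k hk => ?_
    simp [signOf, hk]
  · refine Finset.sum_congr rfl fun k hk => ?_
    rw [show signOf A k = -1 from if_neg (Finset.mem_sdiff.1 hk).2]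
    ring

/-- The likelihood ratio of the white noise law with signal `trigPoly K c` with respect to the
pure noise law. -/
def likelihood {d : ℕ} (n : ℕ) (K : Finset (Fin d → ℤ)) (c : (Fin d → ℤ) → ℝ)
    (Y : Observation d) : ℝ :=
  Real.exp (Y (trigPolyLp K fun k => n * c k) - n * (∑ k ∈ K, c k * c k) / 2)

section Likelihood

variable {d n : ℕ} {P : Measure (Observation d)}

lemma IsWhiteNoiseLaw.tilted_trigPoly (hn : n ≠ 0) (h : IsWhiteNoiseLaw n (fun _ => 0) P)
    (K : Finset (Fin d → ℤ)) (c : (Fin d → ℤ) → ℝ) :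
    IsWhiteNoiseLaw n (trigPoly K c) (P.tilted fun Y => Y (trigPolyLp K fun k => n * c k)) := by
  refine h.tilted hn _ ?_
  filter_upwards [coeFn_trigPolyLp K fun k => n * c k] with x hx
  rw [hx]
  unfold trigPoly
  rw [Finset.mul_sum]
  exact Finset.sum_congr rfl fun k _ => by ring

lemma IsWhiteNoiseLaw.integrable_likelihood (h : IsWhiteNoiseLaw n (fun _ => 0) P)
    (K : Finset (Fin d → ℤ)) (c : (Fin d → ℤ) → ℝ) : Integrable (likelihood n K c) P := by
  unfold likelihood
  simp_rw [Real.exp_sub]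
  exact (h.integral_exp _).1.div_const _

lemma IsWhiteNoiseLaw.tilted_real_eq (hn : n ≠ 0) (h : IsWhiteNoiseLaw n (fun _ => 0) P)
    (K : Finset (Fin d → ℤ)) (c : (Fin d → ℤ) → ℝ) {A : Set (Observation d)}
    (hA : MeasurableSet A) :
    (P.tilted fun Y => Y (trigPolyLp K fun k => n * c k)).real A
      = ∫ Y in A, likelihood n K c Y ∂P := by
  have hn' : (n : ℝ) ≠ 0 := by exact_mod_cast hn
  have e : ∀ Y, Real.exp (Y (trigPolyLp K fun k => n * c k))
      / ∫ Y, Real.exp (Y (trigPolyLp K fun k => n * c k)) ∂P = likelihood n K c Y := by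
    intro Y
    rw [(h.integral_exp _).2, integral_trigPolyLp_mul, ← Real.exp_sub]
    unfold likelihood
    congr 2
    have : ∀ k, n * c k * (n * c k) = n ^ 2 * (c k * c k) := fun k => by ring
    simp_rw [this, ← Finset.mul_sum]
    field_simp
  rw [measureReal_def, tilted_apply_eq_ofReal_integral' _ hA]
  simp_rw [e]
  exact ENNReal.toReal_ofReal (integral_nonneg fun Y => (Real.exp_pos _).le)

lemma IsWhiteNoiseLaw.integral_likelihood_mul (hn : n ≠ 0) (h : IsWhiteNoiseLaw n (fun _ => 0) P)
    (K : Finset (Fin d → ℤ)) (c c' : (Fin d → ℤ) → ℝ) :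
    Integrable (fun Y => likelihood n K c Y * likelihood n K c' Y) P ∧
    ∫ Y, likelihood n K c Y * likelihood n K c' Y ∂P
      = Real.exp (n * ∑ k ∈ K, c k * c' k) := by
  have hn' : (n : ℝ) ≠ 0 := by exact_mod_cast hn
  have e : ∀ Y, likelihood n K c Y * likelihood n K c' Y
      = Real.exp (Y (trigPolyLp K fun k => n * c k) + Y (trigPolyLp K fun k => n * c' k))
        * Real.exp (-(n * (∑ k ∈ K, c k * c k) / 2) - n * (∑ k ∈ K, c' k * c' k) / 2) := by
    intro Y
    unfold likelihood
    rw [← Real.exp_add, ← Real.exp_add]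
    congr 1
    ring
  simp_rw [e]
  obtain ⟨h1, h2⟩ := h.integral_exp_add (trigPolyLp K fun k => n * c k)
    (trigPolyLp K fun k => n * c' k)
  refine ⟨h1.mul_const _, ?_⟩
  rw [integral_mul_const, h2, integral_trigPolyLp_mul, integral_trigPolyLp_mul,
    integral_trigPolyLp_mul, ← Real.exp_add]
  congr 1
  have : ∀ b b' : (Fin d → ℤ) → ℝ, ∑ k ∈ K, n * b k * (n * b' k)
      = n ^ 2 * ∑ k ∈ K, b k * b' k := fun b b' => by
    rw [Finset.mul_sum]
    exact Finset.sum_congr rfl fun k _ => by ring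
  simp_rw [this]
  field_simp
  ring

/-- The average likelihood ratio over the signs of the coefficients. -/
def mixture (n : ℕ) (K : Finset (Fin d → ℤ)) (a : ℝ) (Y : Observation d) : ℝ :=
  (1 / 2 ^ K.card) * ∑ A ∈ K.powerset, likelihood n K (fun k => a * signOf A k) Y

lemma IsWhiteNoiseLaw.integrable_mixture (h : IsWhiteNoiseLaw n (fun _ => 0) P)
    (K : Finset (Fin d → ℤ)) (a : ℝ) : Integrable (mixture n K a) P := by
  unfold mixture
  exact (integrable_finsetSum _ fun A _ => h.integrable_likelihood _ _).const_mul _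

/-- A pair of sign vectors ε, ε' has cross moment exp(na² Σ ε_k ε'_k). Averaging over ε factorizes
into hyperbolic cosines and no longer depends on ε'. -/
lemma IsWhiteNoiseLaw.integral_mixture_sq (hn : n ≠ 0) (h : IsWhiteNoiseLaw n (fun _ => 0) P)
    (K : Finset (Fin d → ℤ)) (a : ℝ) :
    Integrable (fun Y => mixture n K a Y ^ 2) P ∧
    ∫ Y, mixture n K a Y ^ 2 ∂P = Real.cosh (n * a ^ 2) ^ K.card := by
  have e : ∀ Y, mixture n K a Y ^ 2 = (1 / 2 ^ K.card) ^ 2 * ∑ A' ∈ K.powerset, ∑ A ∈ K.powerset,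
      likelihood n K (fun k => a * signOf A k) Y * likelihood n K (fun k => a * signOf A' k) Y := by
    intro Y
    unfold mixture
    rw [mul_pow, sq (∑ A ∈ K.powerset, _), Finset.sum_mul_sum, Finset.sum_comm]
  have hint := fun A A' : Finset (Fin d → ℤ) => (h.integral_likelihood_mul hn K
    (fun k => a * signOf A k) (fun k => a * signOf A' k))
  simp_rw [e]
  refine ⟨(integrable_finsetSum _ fun A' _ => integrable_finsetSum _ fun A _ =>
    (hint A A').1).const_mul _, ?_⟩
  rw [integral_const_mul, integral_finsetSum _ fun A' _ => integrable_finsetSum _ fun A _ =>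
    (hint A A').1]
  have h1 : ∀ A' ∈ K.powerset, ∫ Y, ∑ A ∈ K.powerset,
      likelihood n K (fun k => a * signOf A k) Y * likelihood n K (fun k => a * signOf A' k) Y ∂P
      = (2 * Real.cosh (n * a ^ 2)) ^ K.card := by
    intro A' _
    rw [integral_finsetSum _ fun A _ => (hint A A').1, ← sum_powerset_exp_signOf K A']
    refine Finset.sum_congr rfl fun A _ => ?_
    rw [(hint A A').2]
    congr 1
    rw [mul_assoc, Finset.mul_sum _ _ (a ^ 2)]
    congr 1
    exact Finset.sum_congr rfl fun k _ => by ring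
  rw [Finset.sum_congr rfl h1, Finset.sum_const, Finset.card_powerset, nsmul_eq_mul, mul_pow]
  push_cast
  have : (2 : ℝ) ^ K.card ≠ 0 := by positivity
  field_simp

end Likelihood

/-- Lower bound on the maximal error from the second moment of the likelihood ratio of a mixture
of signals spread over the frequencies in a box. -/
lemma le_maxError {d n s dstar p : ℕ} {κ L r : ℝ} (hn : n ≠ 0) (hp : 1 ≤ p) (hs : s ≤ dstar)
    (hsd : s ≤ d) (hκ : 0 < κ) (hL : p ^ 2 * κ ≤ L) (hr : 0 ≤ r)
    (hB : Real.cosh (n * (κ / p ^ s)) ^ (p ^ s) ≤ r ^ 2 * d.choose s) {c : ℝ} (hc : c < 1 - r)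
    {Jhat : Observation d → Finset (Fin d)} (hJ : IsEstimator Jhat) :
    ENNReal.ofReal c ≤ maxError n dstar s κ L Jhat := by
  obtain ⟨P, hP⟩ := exists_isWhiteNoiseLaw_zero d n
  have hPp := hP.gaussian.isProbabilityMeasure
  by_contra! hlt
  have hps : (0 : ℝ) < (p : ℝ) ^ s := by positivity
  set a : ℝ := √(κ / p ^ s) with ha
  have ha2 : a ^ 2 = κ / p ^ s := Real.sq_sqrt (by positivity)
  set 𝒥 : Finset (Finset (Fin d)) := Finset.powersetCard s Finset.univ with h𝒥
  have hcard : ∀ J ∈ 𝒥, J.card = s := fun J hJ => (Finset.mem_powersetCard.1 hJ).2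
  have hM : 𝒥.card = d.choose s := by simp [h𝒥]
  have hM0 : (0 : ℝ) < 𝒥.card := by
    rw [hM]
    exact_mod_cast Nat.choose_pos hsd
  have hmeas : ∀ J, MeasurableSet {Y | Jhat Y = J} := hJ
  -- If the maximal error were below `c`, each sign vector would give a signal in the class whose
  -- pattern is found with probability above 1 - c; averaging over signs keeps this.
  have hcorrect : ∀ J ∈ 𝒥, 1 - c < ∫ Y in {Y | Jhat Y = J}, mixture n (boxFreq J p) a Y ∂P := by
    intro J hJmem
    have hone : ∀ A : Finset (Fin d → ℤ), 1 - c
        < ∫ Y in {Y | Jhat Y = J}, likelihood n (boxFreq J p) (fun k => a * signOf A k) Y ∂P := by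
      intro A
      have hlaw := hP.tilted_trigPoly hn (boxFreq J p) (fun k => a * signOf A k)
      have hprob := hlaw.gaussian.isProbabilityMeasure
      rw [← hP.tilted_real_eq hn _ _ (hmeas J)]
      set R := P.tilted fun Y => Y (trigPolyLp (boxFreq J p) fun k => n * (a * signOf A k))
      have hcond : ConditionC1 κ L dstar (trigPoly (boxFreq J p) fun k => a * signOf A k) J := by
        refine conditionC1_trigPoly (a := a ^ 2) (by rw [hcard J hJmem]; exact hs) (fun k => ?_) ?_ ?_
        · rw [mul_pow, sq (signOf A k), signOf_mul_self, mul_one]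
        · rw [hcard J hJmem, ha2, mul_div_cancel₀ _ hps.ne']
        · rw [hcard J hJmem, ha2, mul_div_cancel₀ _ hps.ne']
          exact hL
      have herr : R {Y | Jhat Y ≠ J} < ENNReal.ofReal c := by
        refine lt_of_le_of_lt ?_ hlt
        unfold maxError
        exact le_iSup_of_le _ (le_iSup_of_le J (le_iSup_of_le R (le_iSup_of_le hcond
          (le_iSup_of_le (hcard J hJmem) (le_iSup_of_le hlaw le_rfl)))))
      have h1 : R.real {Y | Jhat Y ≠ J} < c := by
        have hc0 : 0 < c := by
          by_contra hc0
          rw [ENNReal.ofReal_of_nonpos (not_lt.1 hc0)] at herr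
          exact not_lt_zero herr
        exact (ENNReal.lt_ofReal_iff_toReal_lt (measure_ne_top _ _)).1 herr
      have h2 : R.real {Y | Jhat Y ≠ J} = 1 - R.real {Y | Jhat Y = J} := by
        rw [← probReal_compl_eq_one_sub (hmeas J)]
        rfl
      linarith
    unfold mixture
    rw [integral_const_mul, integral_finsetSum _ fun A _ =>
      (hP.integrable_likelihood _ _).integrableOn]
    have h2 : (0 : ℝ) < 2 ^ (boxFreq J p).card := by positivity
    rw [one_div, inv_mul_eq_div, lt_div_iff₀ h2]
    have h3 := Finset.sum_lt_sum_of_nonempty (Finset.powerset_nonempty (boxFreq J p))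
      fun A _ => hone A
    rw [Finset.sum_const, Finset.card_powerset, nsmul_eq_mul] at h3
    push_cast at h3
    linarith
  have hcosh : 0 < Real.cosh (n * (κ / p ^ s)) ^ (p ^ s) := pow_pos (Real.cosh_pos _) _
  have htest := sum_setIntegral_le_sqrt (P := P) 𝒥 hmeas
    (fun J J' hne => Set.disjoint_left.2 fun Y h1 h2 => hne (h1.symm.trans h2))
    (fun J _ => hP.integrable_mixture (boxFreq J p) a)
    (fun J _ => (hP.integral_mixture_sq hn (boxFreq J p) a).1) hcosh
    (fun J hJmem => by
      rw [(hP.integral_mixture_sq hn (boxFreq J p) a).2, ha2, card_boxFreq, hcard J hJmem])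
  have hsum : (𝒥.card : ℝ) * (1 - c) ≤ ∑ J ∈ 𝒥, ∫ Y in {Y | Jhat Y = J},
      mixture n (boxFreq J p) a Y ∂P := by
    rw [← nsmul_eq_mul]
    exact Finset.card_nsmul_le_sum _ _ _ fun J hJmem => (hcorrect J hJmem).le
  have hsqrt : √(𝒥.card * Real.cosh (n * (κ / p ^ s)) ^ (p ^ s)) ≤ r * 𝒥.card := by
    refine Real.sqrt_le_iff.2 ⟨by positivity, ?_⟩
    rw [← hM] at hB
    calc (𝒥.card : ℝ) * Real.cosh (n * (κ / p ^ s)) ^ (p ^ s)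
        ≤ 𝒥.card * (r ^ 2 * 𝒥.card) := by gcongr
      _ = _ := by ring
  have : (𝒥.card : ℝ) * (1 - c) ≤ 𝒥.card * r := by linarith
  have := le_of_mul_le_mul_left this hM0
  linarith

/-! ### The lower bound below the rate. -/

/-- Induction through C(d+1, s+1) = (d+1)/(s+1)·C(d, s), using that (d+1)/(s+1) ≤ d/s. -/
lemma div_pow_le_choose {d s : ℕ} (hsd : s ≤ d) : ((d : ℝ) / s) ^ s ≤ d.choose s := by
  induction s generalizing d with
  | zero => simp
  | succ s ih =>
    obtain _ | d := d
    · omega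
    have hsd' : s ≤ d := by omega
    have h1 := ih hsd'
    have h2 : ((d + 1).choose (s + 1) : ℝ) = ((d + 1 : ℕ) : ℝ) / ((s + 1 : ℕ) : ℝ) * d.choose s := by
      have := Nat.add_one_mul_choose_eq d s
      rw [div_mul_eq_mul_div, eq_div_iff (by positivity)]
      exact_mod_cast this.symm
    rw [h2, pow_succ']
    refine mul_le_mul_of_nonneg_left (le_trans ?_ h1) (by positivity)
    rcases Nat.eq_zero_or_pos s with rfl | hs
    · simp
    refine pow_le_pow_left₀ (by positivity) ?_ _
    rw [div_le_div_iff₀ (by positivity) (by positivity)]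
    push_cast
    have : (s : ℝ) ≤ d := by exact_mod_cast hsd'
    nlinarith

lemma exp_le_choose {d s : ℕ} (hs : 1 ≤ s) (hsd : s < d) :
    Real.exp (s * Real.log ((d : ℝ) / s)) ≤ d.choose s := by
  have hs' : (0 : ℝ) < s := by exact_mod_cast hs
  have hd' : (0 : ℝ) < d := by exact_mod_cast hs.trans hsd.le
  rw [Real.exp_nat_mul, Real.exp_log (by positivity)]
  exact div_pow_le_choose hsd.le

lemma cosh_pow_le_exp {x : ℝ} (N : ℕ) : Real.cosh x ^ N ≤ Real.exp (N * (x ^ 2 / 2)) := by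
  rw [Real.exp_nat_mul]
  exact pow_le_pow_left₀ (Real.cosh_pos _).le (Real.cosh_le_exp_half_sq x) _

/-- Below the separation rate, the maximal error is bounded away from zero. -/
lemma le_maxError_of_le_rate {d n s dstar : ℕ} {κ L : ℝ} (hL0 : 0 < L) (hn : 1 ≤ n) (hs : 1 ≤ s)
    (hsd : s < d) (hsds : s ≤ dstar) (hκ : 0 < κ) (hκL : κ ≤ L)
    (hrate : κ ≤ min (1 / 2) (L / 4) * rate n d s)
    {Jhat : Observation d → Finset (Fin d)} (hJ : IsEstimator Jhat) :
    ENNReal.ofReal ((1 - Real.exp (-(1 / 8))) / 2) ≤ maxError n dstar s κ L Jhat := by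
  set D : ℝ := min (1 / 2) (L / 4) with hD
  set ℓ : ℝ := Real.log ((d : ℝ) / s) with hℓ
  have hD0 : 0 < D := lt_min (by norm_num) (by positivity)
  have hD1 : D ≤ 1 / 2 := min_le_left _ _
  have hD2 : D ≤ L / 4 := min_le_right _ _
  have hn' : (0 : ℝ) < n := by exact_mod_cast hn
  have hs' : (1 : ℝ) ≤ s := by exact_mod_cast hs
  have hℓ1 : 1 / (2 * (s : ℝ)) ≤ ℓ := one_div_two_mul_le_log_div hs hsd
  have hsℓ : 1 / 2 ≤ s * ℓ := by
    rw [div_le_iff₀ (by positivity)] at hℓ1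
    linarith
  have hℓ0 : 0 < ℓ := lt_of_lt_of_le (by positivity) hℓ1
  have hr1 : Real.exp (-(1 / 8)) < 1 := by
    rw [Real.exp_lt_one_iff]
    norm_num
  have hchoose : Real.exp (s * ℓ) ≤ d.choose s := exp_le_choose hs hsd
  -- Since sℓ ≥ 1/2, halving the exponent sℓ saves at least 1/4. This is the only gap needed, even
  -- when there are few patterns.
  have hfinish : ∀ B : ℝ, B ≤ Real.exp (s * ℓ / 2) →
      B ≤ Real.exp (-(1 / 8)) ^ 2 * d.choose s := by
    intro B hB
    calc B ≤ Real.exp (s * ℓ / 2) := hB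
      _ ≤ Real.exp (-(1 / 4) + s * ℓ) := Real.exp_le_exp.2 (by linarith)
      _ = Real.exp (-(1 / 8)) ^ 2 * Real.exp (s * ℓ) := by
          rw [← Real.exp_nat_mul, ← Real.exp_add]
          congr 1
          push_cast
          ring
      _ ≤ _ := by gcongr
  rcases le_total ((ℓ / (n : ℝ) ^ 2) ^ ((2 : ℝ) / (4 + s))) (s * ℓ / n) with hcase | hcase
  · have hr : κ ≤ D * (s * ℓ / n) := by
      rw [rate, max_eq_right hcase] at hrate
      exact hrate
    refine le_maxError (p := 1) (by omega) le_rfl hsds hsd.le hκ (by simpa using hκL)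
      (Real.exp_pos _).le (hfinish _ ?_) (by linarith) hJ
    have h1 : n * κ ≤ s * ℓ / 2 := by
      have h2 : D * (s * ℓ / n) ≤ 1 / 2 * (s * ℓ / n) := by gcongr
      have h3 := mul_le_mul_of_nonneg_left (hr.trans h2) hn'.le
      have h4 : n * (1 / 2 * (s * ℓ / n)) = s * ℓ / 2 := by field_simp
      linarith
    have h2 : Real.cosh (n * κ) ≤ Real.exp (n * κ) := by
      have h0 : 0 ≤ n * κ := by positivity
      rw [Real.cosh_eq]
      have := Real.exp_le_exp.2 (show -(n * κ) ≤ n * κ by linarith)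
      linarith
    simp only [Nat.cast_one, one_pow, div_one, pow_one]
    exact h2.trans (Real.exp_le_exp.2 h1)
  · have hr : κ ≤ D * (ℓ / (n : ℝ) ^ 2) ^ ((2 : ℝ) / (4 + s)) := by
      rw [rate, max_eq_left hcase] at hrate
      exact hrate
    set p : ℕ := ⌊√(L / κ)⌋₊ with hp
    have hq1 : 1 ≤ √(L / κ) := Real.one_le_sqrt.2 ((one_le_div hκ).2 hκL)
    have hp1 : 1 ≤ p := Nat.le_floor (by simpa using hq1)
    have hp1' : (1 : ℝ) ≤ p := by exact_mod_cast hp1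
    have hple : (p : ℝ) ≤ √(L / κ) := Nat.floor_le (Real.sqrt_nonneg _)
    have hpge : √(L / κ) ≤ 2 * p := by
      have := Nat.lt_floor_add_one (√(L / κ))
      rw [← hp] at this
      linarith
    have hq2 : √(L / κ) ^ 2 = L / κ := Real.sq_sqrt (by positivity)
    refine le_maxError (p := p) (by omega) hp1 hsds hsd.le hκ ?_
      (Real.exp_pos _).le (hfinish _ ?_) (by linarith) hJ
    · calc (p : ℝ) ^ 2 * κ ≤ √(L / κ) ^ 2 * κ := by gcongr
        _ = L := by rw [hq2]; field_simp
    · refine (cosh_pow_le_exp _).trans (Real.exp_le_exp.2 ?_)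
      push_cast
      set y : ℝ := √(κ / D) with hy
      have hy0 : 0 < y := Real.sqrt_pos.2 (by positivity)
      have hy2 : y ^ 2 = κ / D := Real.sq_sqrt (by positivity)
      have hX : y ^ (4 + s) ≤ ℓ / (n : ℝ) ^ 2 := by
        rw [← sq_le_rpow_iff (by positivity) hy0.le, hy2, div_le_iff₀ hD0, mul_comm]
        exact hr
      -- Here D ≤ L/4 is used: y√(L/κ) = √(L/D) ≥ 2, and the floor loses at most a factor 2. Thus
      -- p^s compensates the factor y^s in the rate.
      have hyp : 1 ≤ y * p := by
        have h1 : 2 ≤ y * √(L / κ) := by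
          rw [hy, ← Real.sqrt_mul (by positivity)]
          refine Real.le_sqrt_of_sq_le ?_
          rw [div_mul_div_comm, mul_comm D κ, mul_div_mul_left _ _ hκ.ne', le_div_iff₀ hD0]
          linarith
        have h2 := mul_le_mul_of_nonneg_left hpge hy0.le
        linarith
      have hκy : κ = y ^ 2 * D := by rw [hy2]; field_simp
      have hps : (0 : ℝ) < (p : ℝ) ^ s := by positivity
      have e : (p : ℝ) ^ s * ((n * (κ / p ^ s)) ^ 2 / 2) = (n * κ) ^ 2 / (2 * p ^ s) := by
        field_simp
      rw [e, div_le_iff₀ (by positivity)]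
      have h5 : (n : ℝ) ^ 2 * y ^ (4 + s) ≤ ℓ := by
        rw [le_div_iff₀ (by positivity)] at hX
        linarith
      have h6 : (1 : ℝ) ≤ (y * p) ^ s := one_le_pow₀ hyp
      have hD3 : D ^ 2 ≤ 1 := by nlinarith
      calc (n * κ) ^ 2 = n ^ 2 * y ^ 4 * D ^ 2 := by rw [hκy]; ring
        _ ≤ n ^ 2 * y ^ 4 * 1 := by gcongr
        _ ≤ n ^ 2 * y ^ 4 * (y * p) ^ s := by gcongr
        _ = n ^ 2 * y ^ (4 + s) * p ^ s := by rw [pow_add, mul_pow]; ring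
        _ ≤ ℓ * p ^ s := by gcongr
        _ ≤ s * ℓ / 2 * (2 * p ^ s) := by
          have h7 : ℓ * 1 ≤ ℓ * s := mul_le_mul_of_nonneg_left hs' hℓ0.le
          have h8 := mul_le_mul_of_nonneg_right h7 hps.le
          linarith

end SparsityPattern

end

theorem mainTheorem5 (L : ℝ) (hL : 0 < L) :
    (∃ Dup : ℝ, 0 < Dup ∧
      ∀ (d dstar : ℕ → ℕ) (κ : ℕ → ℝ), Tendsto d atTop atTop →
        ∃ Jhat : ∀ n, SparsityPattern.Observation (d n) → Finset (Fin (d n)),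
          (∀ n, SparsityPattern.IsEstimator (Jhat n)) ∧
          ∀ (s : ℕ → ℕ) (C : ℝ),
            (∀ᶠ n in atTop, 1 ≤ s n ∧ s n < d n ∧ s n ≤ dstar n ∧ dstar n ≤ d n) →
            (∀ᶠ n in atTop, (dstar n : ℝ) / s n ≤ C) →
            (∀ᶠ n in atTop, Dup * SparsityPattern.rate n (d n) (s n) ≤ κ n) →
            SparsityPattern.UniformlyConsistent L d dstar s κ Jhat) ∧
    (∃ Dlow : ℝ, 0 < Dlow ∧
      ∀ (d dstar s : ℕ → ℕ) (κ : ℕ → ℝ) (C : ℝ),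
        (∀ᶠ n in atTop, 1 ≤ s n ∧ s n < d n ∧ s n ≤ dstar n ∧ dstar n ≤ d n) →
        (∀ᶠ n in atTop, (dstar n : ℝ) / s n ≤ C) →
        (∀ᶠ n in atTop, 0 < κ n ∧ κ n ≤ L) →
        (∀ᶠ n in atTop, κ n ≤ Dlow * SparsityPattern.rate n (d n) (s n)) →
        SparsityPattern.ConsistencyImpossible L d dstar s κ) := by
  constructor
  · refine ⟨4096 * (1 + 450 * L), by positivity, fun d dstar κ hd =>
      ⟨fun n => SparsityPattern.patternEstimator n (d n) (κ n) L,
        fun n => SparsityPattern.isEstimator_patternEstimator _ _ _ _,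
        fun s C hs _ hrate => ?_⟩⟩
    exact SparsityPattern.uniformlyConsistent_patternEstimator hL hd
      (hs.mono fun n h => ⟨h.1, h.2.1⟩) hrate
  · refine ⟨min (1 / 2) (L / 4), lt_min (by norm_num) (by positivity),
      fun d dstar s κ C hs _ hκ hrate =>
        ⟨(1 - Real.exp (-(1 / 8))) / 2, ?_, ?_⟩⟩
    · have : Real.exp (-(1 / 8)) < 1 := by
        rw [Real.exp_lt_one_iff]
        norm_num
      linarith
    · obtain ⟨n₀, hn₀⟩ := eventually_atTop.1 (hs.and (hκ.and hrate))
      refine ⟨max n₀ 1, fun n hn Jhat hJ => ?_⟩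
      obtain ⟨h1, h2, h3⟩ := hn₀ n (le_of_max_le_left hn)
      exact SparsityPattern.le_maxError_of_le_rate hL (le_of_max_le_right hn) h1.1 h1.2.1 h1.2.2.1
        h2.1 h2.2 h3 hJ
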